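/- **Notation.** Let $f\colon\mathbb R^d\to\mathbb R$ be locally Lipschitz. Write $\partial f(x)=\mathrm{conv}\{\lim_j\nabla f(z_j): z_j\to x,\ f \text{ differentiable at each } z_j\}$ for the Clarke subdifferential, and, for $\sigma>0$, $\partial_\sigma f(x)=\mathrm{conv}\bigcup_{\|y-x\|\le\sigma}\partial f(y)$ for the Goldstein subdifferential. For vectors $g,h$ let $\mathrm{mn}[g,h]$ be the element of minimal norm of the segment $[g,h]$. Say that $g$ is *active* at $(x,\sigma)$ if $\|g\|>0$ and $f(x)-f(x-\sigma g/\|g\|)\le\frac{\sigma}{8}\|g\|$. **The algorithm.** * $\mathtt{TDescent}(x,g,\sigma,T)$: start with $a_0=g$, $t=0$; while $t\le T-1$ and $a_t$ is active at $(x,\sigma)$, choose $\hat g_t\in\partial f(x-\sigma a_t/\|a_t\|)$, set $a_{t+1}=\mathrm{mn}[a_t,\hat g_t]$ and $t\leftarrow t+1$. Return $a_t$. * $\mathtt{NDescent}(x,g,\sigma,T)$: start with $b_0=g$, $t=0$; while $t\le T-1$ and $b_t$ is active at $(x,\sigma)$, choose $r$ with $0<r<\sigma\|b_t\|$, sample $\zeta_t$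 uniformly from the ball of radius $r$ around $b_t$, sample $y_t$ uniformly from the segment $[x,\,x-\sigma\zeta_t/\|\zeta_t\|]$, choose $\hat g_t\in\partial f(y_t)$, where (almost surely) $\hat g_t=\nabla f(y_t)$ if $f$ is differentiable at $y_t$, set $b_{t+1}=\mathrm{mn}[b_t,\hat g_t]$ and $t\leftarrow t+1$. Return $b_t$. * $\mathtt{linesearch}(x,g,s,G,T)$: set $v_0=g$; for $i=0,\dots,G-1$ put $\sigma_i=2^{-(G-i)}$, $u_i=\mathtt{TDescent}(x,v_i,\sigma_i,T)$, $v_{i+1}=\mathtt{NDescent}(x,u_i,\sigma_i,T)$. Return a minimizer of $f$ over the finite set $\{x\}\cup\{x-\sigma_i v_{i+1}/\|v_{i+1}\| : 0\le i\le G-1,\ \sigma_i\le\|v_{i+1}\|/s\}$. * $\mathtt{NTDescent}(x_0,g_0,c_0,\{G_k\},\{T_k\})$: for $k=0,1,\dots$ set $x_{k+1}=\mathtt{linesearch}(x_k,g_k,\max\{\|g_k\|,c_0\|g_0\|\},G_k,T_k)$ and choose $g_{k+1}\in\partial f(x_{k+1})$. The random draws are fresh, i.e. independent of the past, and every choice is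 a random variable depending only on what has happened before it (possibly with additional randomization), but is otherwise arbitrary. **Theorem (Sublinear convergence).** Let $f\colon\mathbb R^d\to\mathbb R$ be locally Lipschitz, $x_0\in\mathbb R^d$, $g_0\in\partial f(x_0)$, $g_0\ne0$. Let $L\in[0,+\infty]$ be any Lipschitz constant of $f$ on $S=\{x+u: f(x)\le f(x_0),\ \|u\|\le1\}$. Fix $c_0\in(0,1]$, sequences $\{T_k\}$, $\{G_k\}$ of positive integers, and $p\in(0,1)$, and let $\{x_k\}$ be generated by $\mathtt{NTDescent}(x_0,g_0,c_0,\{G_k\},\{T_k\})$. Then for every integer $K>0$, with $G=\min_{K\le k\le 2K-1}G_k$, $T=\min_{K\le k\le 2K-1}T_k$ and $\sigma_i=2^{-(G-i)}$, the following holds with probability at least $1-p$: for all $0\le i\le G$, $$\min_{K\le k\le2K-1}\mathrm{dist}(0,\partial_{\sigma_i}f(x_k))\le M_i:=\max\left\{\frac{8(f(x_K)-\inf f)}{\sigma_iK},\ \frac{16L\sqrt{2\log(KG/p)}}{\sqrt T},\ \sqrt{128}\,L\sigma_i\right\},$$ and, if moreover $f$ is convex and $D=\mathrm{diam}\{x: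 f(x)\le f(x_0)\}$, then $$f(x_{2K-1})-\inf f\le\min_{0\le i\le G}\left\{D\,M_i+2L\sigma_i\right\}.$$ (Right-hand sides are read in the extended reals; $L$, $D$ and $-\inf f$ may be $+\infty$.) -/

import Mathlib

open MeasureTheory ProbabilityTheory Filter Topology Set

noncomputable section

namespace NTDescent

/-- The Euclidean space of dimension `d`. -/
abbrev E (d : ℕ) := EuclideanSpace ℝ (Fin d)

variable {d : ℕ}

/-- The Clarke subdifferential: the convex hull of all limits of gradients of `f` along sequences
of differentiability points converging to `x`. -/
def clarke (f : E d → ℝ) (x : E d) : Set (E d) :=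
  convexHull ℝ {v | ∃ s : ℕ → E d, (∀ n, DifferentiableAt ℝ f (s n)) ∧
    Tendsto s atTop (𝓝 x) ∧ Tendsto (fun n => gradient f (s n)) atTop (𝓝 v)}

/-- The Goldstein subdifferential: the convex hull of all Clarke subgradients at points of the
closed ball of radius `σ` around `x`. -/
def goldstein (f : E d → ℝ) (σ : ℝ) (x : E d) : Set (E d) :=
  convexHull ℝ (⋃ y ∈ Metric.closedBall x σ, clarke f y)

/-- The normalized step `x - σ g / ‖g‖`. -/
def normStep (x : E d) (σ : ℝ) (g : E d) : E d := x - (σ / ‖g‖) • g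

/-- `z` is the element of minimal norm of the segment `[g, h]`. -/
def IsMinNormOnSegment (g h z : E d) : Prop :=
  z ∈ segment ℝ g h ∧ ∀ w ∈ segment ℝ g h, ‖z‖ ≤ ‖w‖

/-- The part of the loop condition, common to the two inner methods, that concerns the current
vector `g`: it is nonzero and the step along it does not give sufficient descent. -/
def LoopActive (f : E d → ℝ) (x : E d) (σ : ℝ) (g : E d) : Prop :=
  0 < ‖g‖ ∧ f x - f (normStep x σ g) ≤ σ / 8 * ‖g‖

/-- `a 0, a 1, …, a T` is a run of the tangent descent loop started at `g` with budget `T`. After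
the loop has stopped, the sequence is constant, so that the vector returned is `a T`. -/
def IsTDescentRun (f : E d → ℝ) (x : E d) (σ : ℝ) (T : ℕ) (g : E d) (a : ℕ → E d) : Prop :=
  a 0 = g ∧ ∀ t < T,
    (LoopActive f x σ (a t) →
      ∃ h ∈ clarke f (normStep x σ (a t)), IsMinNormOnSegment (a t) h (a (t + 1))) ∧
    (¬ LoopActive f x σ (a t) → a (t + 1) = a t)

/-- The point of the segment `[x, x - σ ζ / ‖ζ‖]` at parameter `θ`, where `ζ = g + r ξ`. If `ξ` is
uniform on the unit ball then `ζ` is uniform on the ball of radius `r` around `g`, and if `θ` is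
uniform on `[0, 1]` and independent of `ξ` then the point is uniform on the segment. -/
def samplePoint (x : E d) (σ : ℝ) (g : E d) (r : ℝ) (ξ : E d) (θ : ℝ) : E d :=
  x - (θ * (σ / ‖g + r • ξ‖)) • (g + r • ξ)

/-- `b 0, b 1, …, b T` is a run of the normal descent loop started at `g` with budget `T`, with
perturbation radii `r t`, normalized random draws `ξ t` (unit ball) and `θ t` (unit interval), and
subgradients `h t` at the sampled points. After the loop has stopped, the sequence is constant, so
that the vector returned is `b T`. -/
def IsNDescentRun (f : E d → ℝ) (x : E d) (σ : ℝ) (T : ℕ) (g : E d) (b : ℕ → E d)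
    (r : ℕ → ℝ) (ξ : ℕ → E d) (θ : ℕ → ℝ) (h : ℕ → E d) : Prop :=
  b 0 = g ∧ ∀ t < T,
    (LoopActive f x σ (b t) →
      0 < r t ∧ r t < σ * ‖b t‖ ∧
      h t ∈ clarke f (samplePoint x σ (b t) (r t) (ξ t) (θ t)) ∧
      IsMinNormOnSegment (b t) (h t) (b (t + 1))) ∧
    (¬ LoopActive f x σ (b t) → b (t + 1) = b t)

/-- The grid radius `2 ^ (-(G - i))`. -/
def gridRadius (G i : ℕ) : ℝ := (2 : ℝ) ^ (-((G : ℤ) - (i : ℤ)))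

/-- The candidates among which the line search picks its output: the point `x` and all steps
`x - σᵢ vᵢ₊₁ / ‖vᵢ₊₁‖`, `i < G`, that obey the trust region constraint `σᵢ ≤ ‖vᵢ₊₁‖ / s`. -/
def candidates (x : E d) (s : ℝ) (G : ℕ) (v : ℕ → E d) : Set (E d) :=
  {x} ∪ {z | ∃ i < G, gridRadius G i ≤ ‖v (i + 1)‖ / s ∧
    z = normStep x (gridRadius G i) (v (i + 1))}

/-- The random draw number `t` of the call of normal descent at grid index `i` of outer iteration
`k`; draws are ordered lexicographically, that is, chronologically. -/
def stage (k i t : ℕ) : ℕ ×ₗ ℕ ×ₗ ℕ := toLex (k, toLex (i, t))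

/-- A random trajectory of the normal tangent descent algorithm with initial point `x₀`, initial
subgradient `g₀`, scalar `c₀`, grid sizes `Gs` and budgets `Ts`, on the probability space `(Ω, μ)`.

Everything the algorithm leaves open (subgradients, perturbation radii, ties in the line search)
is chosen in an arbitrary way, possibly at random, that depends only on the past. -/
structure Run {Ω : Type*} [mΩ : MeasurableSpace Ω] (μ : Measure Ω) (f : E d → ℝ) (x₀ g₀ : E d)
    (c₀ : ℝ) (Gs Ts : ℕ → ℕ) where
  /-- outer iterates -/
  x : ℕ → Ω → E d
  /-- subgradients chosen at the outer iterates -/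
  g : ℕ → Ω → E d
  /-- vectors `v k i`, `i ≤ Gs k`, of the line search of outer iteration `k` -/
  v : ℕ → ℕ → Ω → E d
  /-- inner iterates of tangent descent -/
  a : ℕ → ℕ → ℕ → Ω → E d
  /-- inner iterates of normal descent -/
  b : ℕ → ℕ → ℕ → Ω → E d
  /-- perturbation radii of normal descent -/
  r : ℕ → ℕ → ℕ → Ω → ℝ
  /-- normalized draws from the unit ball -/
  ξ : ℕ → ℕ → ℕ → Ω → E d
  /-- draws from the unit interval -/
  θ : ℕ → ℕ → ℕ → Ω → ℝ
  /-- subgradients chosen at the points sampled by normal descent -/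
  h : ℕ → ℕ → ℕ → Ω → E d
  /-- `hist (stage k i t)` is the information available just before the draws `ξ k i t`, `θ k i t`
  are made -/
  hist : Filtration (ℕ ×ₗ ℕ ×ₗ ℕ) mΩ
  x_zero : ∀ ω, x 0 ω = x₀
  g_zero : ∀ ω, g 0 ω = g₀
  g_mem : ∀ k ω, g k ω ∈ clarke f (x k ω)
  v_zero : ∀ k ω, v k 0 ω = g k ω
  tangent : ∀ k, ∀ i < Gs k, ∀ ω,
    IsTDescentRun f (x k ω) (gridRadius (Gs k) i) (Ts k) (v k i ω) (fun t => a k i t ω)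
  normal : ∀ k, ∀ i < Gs k, ∀ ω,
    IsNDescentRun f (x k ω) (gridRadius (Gs k) i) (Ts k) (a k i (Ts k) ω)
      (fun t => b k i t ω) (fun t => r k i t ω) (fun t => ξ k i t ω) (fun t => θ k i t ω)
      (fun t => h k i t ω)
  v_succ : ∀ k, ∀ i < Gs k, ∀ ω, v k (i + 1) ω = b k i (Ts k) ω
  x_succ_mem : ∀ k ω, x (k + 1) ω ∈
    candidates (x k ω) (max ‖g k ω‖ (c₀ * ‖g₀‖)) (Gs k) (fun i => v k i ω)
  x_succ_le : ∀ k ω, ∀ z ∈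
    candidates (x k ω) (max ‖g k ω‖ (c₀ * ‖g₀‖)) (Gs k) (fun i => v k i ω),
    f (x (k + 1) ω) ≤ f z
  /-- At a point of differentiability, the subgradient used by normal descent is the gradient
  (almost surely). -/
  h_eq_gradient : ∀ k, ∀ i < Gs k, ∀ t < Ts k, ∀ᵐ ω ∂μ,
    LoopActive f (x k ω) (gridRadius (Gs k) i) (b k i t ω) →
    DifferentiableAt ℝ f
      (samplePoint (x k ω) (gridRadius (Gs k) i) (b k i t ω) (r k i t ω) (ξ k i t ω)
        (θ k i t ω)) →
    h k i t ω = gradient f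
      (samplePoint (x k ω) (gridRadius (Gs k) i) (b k i t ω) (r k i t ω) (ξ k i t ω)
        (θ k i t ω))
  x_adapted : ∀ k, Measurable[hist (stage k 0 0)] (x k)
  g_adapted : ∀ k, Measurable[hist (stage k 0 0)] (g k)
  a_adapted : ∀ k, ∀ i < Gs k, ∀ t ≤ Ts k, Measurable[hist (stage k i 0)] (a k i t)
  b_adapted : ∀ k, ∀ i < Gs k, ∀ t ≤ Ts k, Measurable[hist (stage k i t)] (b k i t)
  r_adapted : ∀ k, ∀ i < Gs k, ∀ t < Ts k, Measurable[hist (stage k i t)] (r k i t)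
  ξ_adapted : ∀ k, ∀ i < Gs k, ∀ t < Ts k, Measurable[hist (stage k i (t + 1))] (ξ k i t)
  θ_adapted : ∀ k, ∀ i < Gs k, ∀ t < Ts k, Measurable[hist (stage k i (t + 1))] (θ k i t)
  h_adapted : ∀ k, ∀ i < Gs k, ∀ t < Ts k, Measurable[hist (stage k i (t + 1))] (h k i t)
  ξ_uniform : ∀ k, ∀ i < Gs k, ∀ t < Ts k,
    pdf.IsUniform (ξ k i t) (Metric.ball (0 : E d) 1) μ volume
  θ_uniform : ∀ k, ∀ i < Gs k, ∀ t < Ts k,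
    pdf.IsUniform (θ k i t) (Icc (0 : ℝ) 1) μ volume
  ξ_indep_θ : ∀ k, ∀ i < Gs k, ∀ t < Ts k, IndepFun (ξ k i t) (θ k i t) μ
  draws_indep_past : ∀ k, ∀ i < Gs k, ∀ t < Ts k,
    Indep (MeasurableSpace.comap (fun ω => (ξ k i t ω, θ k i t ω)) inferInstance)
      (hist (stage k i t)) μ

/-- The sublevel set `{x | f x ≤ f x₀}`. -/
def sublevel (f : E d → ℝ) (x₀ : E d) : Set (E d) := {x | f x ≤ f x₀}

/-- The sublevel set of `x₀` widened by the closed unit ball. -/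
def widenedSublevel (f : E d → ℝ) (x₀ : E d) : Set (E d) :=
  {z | ∃ x ∈ sublevel f x₀, ∃ u ∈ Metric.closedBall (0 : E d) 1, z = x + u}

/-- The function gap `f x - inf f`; it is `+∞` if `f` is unbounded below. -/
def gap (f : E d → ℝ) (x : E d) : EReal := (f x : EReal) - ⨅ y, (f y : EReal)

/-- `max {8 Δ / (σ K), 16 L √(2 log (K G / p)) / √T, √128 L σ}` in the extended reals, `Δ` being
a function gap. -/
def rate (Δ : EReal) (L : ENNReal) (σ : ℝ) (K G T : ℕ) (p : ℝ) : EReal :=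
  max (8 * Δ / ((σ * K : ℝ) : EReal))
    (max ((L : EReal) * ((16 * √(2 * Real.log (K * G / p)) / √(T : ℝ) : ℝ) : EReal))
      ((L : EReal) * ((√128 * σ : ℝ) : EReal)))

end NTDescent

end

namespace NTDescent

variable {d : ℕ} {f : E d → ℝ} {x₀ x y z : E d} {L : NNReal} {σ : ℝ}

/-! ### Lipschitz bounds near the sublevel set -/

/-! Fix an outer iteration and a grid radius `σ`. All vectors produced by the inner loops up to that
radius lie in the Goldstein subdifferential. If this set has distance more than `M` from `0`, the
vector `v` returned by normal descent is longer than `M`. If moreover the loop has stopped by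
itself, then stepping along `v` lowers `f` by more than `σ M / 8`, and the trust region admits the
step because its scale is at most `L` and `L σ ≤ M`. When `M` is at least `8 (f (x_K) - inf f) / (σ
K)`, having `K` such decreases in a row would push `f` below its infimum (`Run.descent`,
`Run.exists_infDist_le`). So the task is to bound the probability that a call exhausts its budget
while still active and longer than `M`.

While the loop is active at `b`, the fundamental theorem of calculus along the segment turns the
poor decrease of `f` into a bound on a mean: `⟪∇f, b⟫` averages to at most `‖b‖² / 2`
(`integral_inner_gradient_le`). The random tilt of `b` makes almost every point of the segment a
point of differentiability. Hence the sampled gradient shortens `b` on average. This is measured by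
the potential `exp (-M² / ‖b‖²)`: its value after a step is bounded by its old value times a
function affine in `⟪b, h⟫` (`exp_potential_le`), so expectations can be taken, and each step
contracts its mean by `1 - M² / (32 L²)` (`lintegral_potential_step`). On critical states the
potential lies between `1 / e` and `1`, so a call with budget `T` fails with probability at most
`exp (1 - T M² / (32 L²))` (`Run.measure_critical_le`). A union bound over at most `K G` calls gives
`p` (`Run.measure_not_successful_le`).

For convex `f`, an element `v` of the Goldstein subdifferential bounds the gap by `‖v‖ D + 2 L σ`
(`sub_le_of_mem_goldstein`). -/

theorem norm_gradient_eq (f : E d → ℝ) (y : E d) : ‖gradient f y‖ = ‖fderiv ℝ f y‖ := by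
  simp [gradient]

theorem inner_gradient (f : E d → ℝ) (y v : E d) : inner ℝ (gradient f y) v = fderiv ℝ f y v := by
  simp [gradient]

/-- The ball is taken open so that the constant also bounds gradients at each of its points. The
price is that the radius `σ = 1`, whose closed ball sticks out, has to be treated separately. -/
theorem lipschitzOnWith_ball
    (hL : ∀ x ∈ widenedSublevel f x₀, ∀ y ∈ widenedSublevel f x₀, edist (f x) (f y) ≤ L * edist x y)
    (hx : f x ≤ f x₀) : LipschitzOnWith L f (Metric.ball x 1) := by
  have key : ∀ y ∈ Metric.ball x 1, y ∈ widenedSublevel f x₀ := fun y hy =>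
    ⟨x, hx, y - x, by simpa [dist_eq_norm] using (mem_ball_iff_norm.1 hy).le, by abel⟩
  exact fun y hy z hz => hL y (key y hy) z (key z hz)

theorem norm_gradient_le (hf : LipschitzOnWith L f (Metric.ball x 1)) (hy : y ∈ Metric.ball x 1) :
    ‖gradient f y‖ ≤ L := by
  rw [norm_gradient_eq]
  exact norm_fderiv_le_of_lipschitzOn ℝ (Metric.isOpen_ball.mem_nhds hy) hf

theorem abs_sub_le_of_mem_ball (hf : LipschitzOnWith L f (Metric.ball x 1))
    (hy : y ∈ Metric.ball x 1) (hz : z ∈ Metric.ball x 1) : |f y - f z| ≤ L * ‖y - z‖ := by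
  simpa [dist_eq_norm] using hf.dist_le_mul y hy z hz

theorem norm_le_of_mem_clarke (hf : LipschitzOnWith L f (Metric.ball x 1))
    (hy : y ∈ Metric.ball x 1) {v : E d} (hv : v ∈ clarke f y) : ‖v‖ ≤ L := by
  have : clarke f y ⊆ Metric.closedBall 0 L := by
    refine convexHull_min ?_ (convex_closedBall _ _)
    rintro w ⟨s, -, hs, hw⟩
    rw [mem_closedBall_zero_iff]
    refine le_of_tendsto hw.norm ?_
    filter_upwards [hs.eventually (Metric.isOpen_ball.mem_nhds hy)] with n hn
    exact norm_gradient_le hf hn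
  simpa using this hv

theorem clarke_subset_goldstein (h : ‖y - x‖ ≤ σ) : clarke f y ⊆ goldstein f σ x :=
  (subset_biUnion_of_mem (u := fun y => clarke f y) (mem_closedBall_iff_norm.2 h)).trans
    (subset_convexHull ℝ _)

theorem goldstein_mono {τ : ℝ} (h : σ ≤ τ) : goldstein f σ x ⊆ goldstein f τ x :=
  convexHull_mono (biUnion_subset_biUnion_left (Metric.closedBall_subset_closedBall h))

theorem norm_le_of_mem_goldstein (hf : LipschitzOnWith L f (Metric.ball x 1)) (hσ : σ < 1)
    {v : E d} (hv : v ∈ goldstein f σ x) : ‖v‖ ≤ L := by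
  have : goldstein f σ x ⊆ Metric.closedBall 0 L := by
    refine convexHull_min (iUnion₂_subset fun y hy v hv => ?_) (convex_closedBall _ _)
    rw [mem_closedBall_zero_iff]
    exact norm_le_of_mem_clarke hf (Metric.closedBall_subset_ball hσ hy) hv
  simpa using this hv

/-! ### Minimal norm elements of segments and the potential -/

theorem IsMinNormOnSegment.mem_of_convex {s : Set (E d)} (hs : Convex ℝ s) {g h z : E d}
    (hz : IsMinNormOnSegment g h z) (hg : g ∈ s) (hh : h ∈ s) : z ∈ s :=
  hs.segment_subset hg hh hz.1

theorem IsMinNormOnSegment.norm_le {g h z : E d} (hz : IsMinNormOnSegment g h z) : ‖z‖ ≤ ‖g‖ :=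
  hz.2 g (left_mem_segment ℝ g h)

/-- Every point of the segment bounds the squared norm of the minimizer. -/
theorem IsMinNormOnSegment.norm_sq_le {g h z : E d} (hz : IsMinNormOnSegment g h z)
    {t : ℝ} (ht : t ∈ Icc (0 : ℝ) 1) :
    ‖z‖ ^ 2 ≤ ‖g‖ ^ 2 - 2 * t * (‖g‖ ^ 2 - inner ℝ g h) + t ^ 2 * ‖h - g‖ ^ 2 := by
  have hmem : g + t • (h - g) ∈ segment ℝ g h := by
    rw [segment_eq_image']
    exact ⟨t, ht, rfl⟩
  have h1 := hz.2 _ hmem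
  have h2 : ‖g + t • (h - g)‖ ^ 2
      = ‖g‖ ^ 2 - 2 * t * (‖g‖ ^ 2 - inner ℝ g h) + t ^ 2 * ‖h - g‖ ^ 2 := by
    rw [norm_add_sq_real, inner_smul_right, inner_sub_right, real_inner_self_eq_norm_sq, norm_smul,
      mul_pow, Real.norm_eq_abs, sq_abs]
    ring
  rw [← h2]
  gcongr

/-- The decrease of the potential `exp (-M² / ‖b‖²)` in one step of normal descent. -/
theorem exp_potential_le {g h z : E d} {M : ℝ} (hz : IsMinNormOnSegment g h z)
    (hM : 0 < M) (hg : M < ‖g‖) (hgL : ‖g‖ ≤ L) (hhL : ‖h‖ ≤ L) (hMz : M < ‖z‖) :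
    Real.exp (-(M ^ 2 / ‖z‖ ^ 2)) ≤ Real.exp (-(M ^ 2 / ‖g‖ ^ 2)) *
      (1 - M ^ 2 / (8 * L ^ 2) * (3 / 4 - inner ℝ g h / ‖g‖ ^ 2)) := by
  set m := ‖g‖ with hm
  have hm0 : 0 < m := hM.trans hg
  have hL0 : (0 : ℝ) < L := hm0.trans_le hgL
  set q : ℝ := inner ℝ g h with hq
  have hqb : |q| ≤ m * L := (abs_real_inner_le_norm g h).trans (by gcongr)
  -- With `‖h - g‖² ≤ 4 L²`, the quadratic bound on `‖z‖²` is minimized over `t ≥ 0` at `t = Y / (4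
  -- L²)`; the positive part keeps `t` admissible.
  set Y : ℝ := max (m ^ 2 - q) 0 with hY
  have hY0 : 0 ≤ Y := le_max_right _ _
  have hY1 : m ^ 2 - q ≤ Y := le_max_left _ _
  have hYb : Y ≤ 2 * m * L := by
    refine max_le ?_ (by positivity)
    nlinarith [neg_abs_le q]
  have hYsq : Y * (m ^ 2 - q) = Y ^ 2 := by
    rcases max_cases (m ^ 2 - q) 0 with h | h <;> rw [hY, h.1] <;> ring
  have hhg : ‖h - g‖ ^ 2 ≤ 4 * (L : ℝ) ^ 2 := by
    have : ‖h - g‖ ≤ 2 * L := (norm_sub_le _ _).trans (by linarith)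
    nlinarith [norm_nonneg (h - g)]
  have ht1 : Y / (4 * L ^ 2) ≤ 1 := by
    rw [div_le_one (by positivity)]
    nlinarith
  have h1 := hz.norm_sq_le (t := Y / (4 * L ^ 2)) ⟨by positivity, ht1⟩
  have h2 : ‖z‖ ^ 2 ≤ m ^ 2 - Y ^ 2 / (4 * L ^ 2) := by
    have h3 : (Y / (4 * (L : ℝ) ^ 2)) ^ 2 * ‖h - g‖ ^ 2
        ≤ (Y / (4 * (L : ℝ) ^ 2)) ^ 2 * (4 * (L : ℝ) ^ 2) := by gcongr
    have h4 : (Y / (4 * (L : ℝ) ^ 2)) ^ 2 * (4 * (L : ℝ) ^ 2) = Y ^ 2 / (4 * L ^ 2) := by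
      field_simp
    have h5 : 2 * (Y / (4 * (L : ℝ) ^ 2)) * (m ^ 2 - q) = 2 * (Y ^ 2 / (4 * L ^ 2)) := by
      rw [← hYsq]; ring
    linarith
  have hz0 : 0 < ‖z‖ ^ 2 := by have := hM.trans hMz; positivity
  -- A lower bound for the growth of the exponent `M² / ‖·‖²` in the step.
  set s : ℝ := M ^ 2 * Y ^ 2 / (4 * L ^ 2 * m ^ 4) with hs
  have hs0 : 0 ≤ s := by positivity
  have hs1 : s ≤ 1 := by
    rw [hs, div_le_one (by positivity)]
    have h6 : Y ^ 2 ≤ (2 * m * L) ^ 2 := by gcongr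
    have h7 : M ^ 2 ≤ m ^ 2 := by gcongr
    calc M ^ 2 * Y ^ 2 ≤ m ^ 2 * (2 * m * L) ^ 2 := by gcongr
      _ = _ := by ring
  have h8 : M ^ 2 / m ^ 2 + s ≤ M ^ 2 / ‖z‖ ^ 2 := by
    rw [le_div_iff₀ hz0]
    have h9 : (M ^ 2 / m ^ 2 + s) * ‖z‖ ^ 2
        ≤ (M ^ 2 / m ^ 2 + s) * (m ^ 2 - Y ^ 2 / (4 * L ^ 2)) := by gcongr
    have h10 : (M ^ 2 / m ^ 2 + s) * (m ^ 2 - Y ^ 2 / (4 * L ^ 2))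
        = M ^ 2 - s * (Y ^ 2 / (4 * L ^ 2)) := by
      rw [hs]; field_simp; ring
    have : 0 ≤ s * (Y ^ 2 / (4 * L ^ 2)) := by positivity
    linarith
  -- On `[-1, 0]` the exponential lies below its chord, and `e⁻¹ ≤ 1 / 2`.
  have h11 : Real.exp (-s) ≤ 1 - s / 2 := by
    have hconv := convexOn_exp.2 (mem_univ (-1)) (mem_univ 0) hs0 (sub_nonneg.2 hs1) (by ring)
    have he : Real.exp (-1) ≤ 1 / 2 := by
      rw [Real.exp_neg, one_div]
      gcongr
      linarith [Real.add_one_le_exp (1 : ℝ)]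
    simp only [smul_eq_mul, mul_zero, add_zero, Real.exp_zero, mul_one] at hconv
    rw [mul_neg_one] at hconv
    nlinarith
  have h12 : 1 - s / 2 ≤ 1 - M ^ 2 / (8 * L ^ 2) * (3 / 4 - q / m ^ 2) := by
    have h13 : s / 2 = M ^ 2 / (8 * L ^ 2) * (Y / m ^ 2) ^ 2 := by
      rw [hs]; field_simp; ring
    -- The square is replaced by its tangent at `1 / 2`, that is `y² ≥ y - 1 / 4`. This makes the
    -- bound affine in `q`, so that only the mean of `q` will matter.
    have h14 : 3 / 4 - q / m ^ 2 ≤ (Y / m ^ 2) ^ 2 := by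
      have h15 : 1 - q / m ^ 2 ≤ Y / m ^ 2 := by
        rw [le_div_iff₀ (by positivity), sub_mul, div_mul_cancel₀ _ (by positivity)]
        linarith
      nlinarith [sq_nonneg (Y / m ^ 2 - 1 / 2)]
    rw [h13]
    gcongr
  calc Real.exp (-(M ^ 2 / ‖z‖ ^ 2)) ≤ Real.exp (-(M ^ 2 / m ^ 2) + -s) := by
        apply Real.exp_le_exp.2; linarith
    _ = Real.exp (-(M ^ 2 / m ^ 2)) * Real.exp (-s) := Real.exp_add _ _
    _ ≤ _ := by
        gcongr
        exact h11.trans h12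

/-! ### Elementary facts on the steps -/

theorem norm_normStep_sub_le (hσ : 0 ≤ σ) (g : E d) : ‖normStep x σ g - x‖ ≤ σ := by
  rw [normStep, sub_sub_cancel_left, norm_neg, norm_smul, norm_div, norm_norm,
    Real.norm_of_nonneg hσ]
  rw [div_mul_comm, mul_comm]
  exact mul_le_of_le_one_right hσ (div_self_le_one _)

theorem samplePoint_eq (g : E d) (r : ℝ) (ξ : E d) (θ : ℝ) :
    samplePoint x σ g r ξ θ = x - (θ * σ) • (‖g + r • ξ‖⁻¹ • (g + r • ξ)) := by
  rw [samplePoint, smul_smul, mul_div_assoc', div_eq_mul_inv]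

theorem norm_normalize_le_one (w : E d) : ‖‖w‖⁻¹ • w‖ ≤ 1 := by
  rw [norm_smul, norm_inv, norm_norm]
  exact inv_mul_le_one_of_le₀ le_rfl (norm_nonneg _)

theorem norm_samplePoint_sub_le (hσ : 0 ≤ σ) (g : E d) (r : ℝ) (ξ : E d) {θ : ℝ}
    (hθ : θ ∈ Icc (0 : ℝ) 1) : ‖samplePoint x σ g r ξ θ - x‖ ≤ σ := by
  rw [samplePoint_eq, sub_sub_cancel_left, norm_neg, norm_smul, Real.norm_of_nonneg
    (mul_nonneg hθ.1 hσ)]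
  calc θ * σ * _ ≤ 1 * σ * 1 := by
        gcongr
        · exact hθ.2
        · exact norm_normalize_le_one _
    _ = σ := by ring

/-- Normalization is Lipschitz at `b`, with constant `2 / ‖b‖`. -/
theorem norm_normalize_sub_le {b w : E d} (hb : b ≠ 0) (hw : w ≠ 0) :
    ‖‖w‖⁻¹ • w - ‖b‖⁻¹ • b‖ ≤ 2 * ‖w - b‖ / ‖b‖ := by
  have hb' : 0 < ‖b‖ := norm_pos_iff.2 hb
  have hw' : 0 < ‖w‖ := norm_pos_iff.2 hw
  have h1 : ‖w‖⁻¹ • w - ‖b‖⁻¹ • b = (‖w‖⁻¹ - ‖b‖⁻¹) • w + ‖b‖⁻¹ • (w - b) := by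
    rw [sub_smul, smul_sub]; abel
  have h2 : ‖(‖w‖⁻¹ - ‖b‖⁻¹) • w‖ ≤ ‖w - b‖ / ‖b‖ := by
    rw [norm_smul, inv_sub_inv hw'.ne' hb'.ne', norm_div, norm_mul, norm_norm, norm_norm]
    have : ‖‖b‖ - ‖w‖‖ ≤ ‖w - b‖ := by
      rw [norm_sub_rev w b]; exact abs_norm_sub_norm_le b w
    calc ‖‖b‖ - ‖w‖‖ / (‖w‖ * ‖b‖) * ‖w‖ = ‖‖b‖ - ‖w‖‖ / ‖b‖ := by field_simp
      _ ≤ _ := by gcongr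
  have h3 : ‖‖b‖⁻¹ • (w - b)‖ = ‖w - b‖ / ‖b‖ := by
    rw [norm_smul, norm_inv, norm_norm]; ring
  rw [h1]
  calc _ ≤ _ := norm_add_le _ _
    _ ≤ ‖w - b‖ / ‖b‖ + ‖w - b‖ / ‖b‖ := by rw [h3]; gcongr
    _ = _ := by ring

/-! ### Differentiability at random points of random segments -/

theorem ae_differentiableAt_of_mem_ball (hf : LipschitzOnWith L f (Metric.ball x 1)) :
    ∀ᵐ y, y ∈ Metric.ball x 1 → DifferentiableAt ℝ f y := by
  filter_upwards [hf.ae_differentiableWithinAt_of_mem (μ := volume)] with y h hy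
  exact (h hy).differentiableAt (Metric.isOpen_ball.mem_nhds hy)

/-- By Fubini the quantifiers may be exchanged. For fixed `s ≠ 0` the map `ξ ↦ x - s (b + r ξ)` is
an invertible affine map, which pulls null sets back to null sets. -/
theorem ae_of_affine_ray {P : E d → Prop} (hP : ∀ᵐ y, P y) (hPm : MeasurableSet {y | P y})
    (x b : E d) {r : ℝ} (hr : r ≠ 0) :
    ∀ᵐ ξ : E d, ∀ᵐ s : ℝ, P (x - s • (b + r • ξ)) := by
  rw [Measure.ae_ae_comm]
  · have h0 : ∀ᵐ s : ℝ, s ≠ 0 := by simp [ae_iff]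
    filter_upwards [h0] with s hs
    have hq : Measure.QuasiMeasurePreserving (fun ξ : E d => (x - s • b) + (-(s * r)) • ξ)
        volume volume :=
      (measurePreserving_add_left volume (x - s • b)).quasiMeasurePreserving.comp
        (Measure.quasiMeasurePreserving_smul volume (by simp [hs, hr]))
    filter_upwards [hq.ae hP] with ξ hξ
    convert hξ using 1
    module
  · exact (by fun_prop : Measurable fun q : E d × ℝ => x - q.2 • (b + r • q.1)) hPm

theorem add_smul_ne_zero {b ξ : E d} {r : ℝ} (hr : 0 < r) (hrb : r < ‖b‖) (hξ : ‖ξ‖ < 1) :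
    b + r • ξ ≠ 0 := by
  intro h
  have h1 : ‖b‖ = r * ‖ξ‖ := by
    rw [eq_neg_of_add_eq_zero_left h, norm_neg, norm_smul, Real.norm_of_nonneg hr.le]
  nlinarith

theorem ae_differentiableAt_samplePoint (hf : LipschitzOnWith L f (Metric.ball x 1))
    (hσ0 : 0 < σ) (hσ1 : σ < 1) {b : E d} {r : ℝ} (hr : 0 < r) (hrb : r < ‖b‖) :
    ∀ᵐ ξ : E d, ‖ξ‖ < 1 → ∀ᵐ θ : ℝ, θ ∈ Icc (0 : ℝ) 1 →
      DifferentiableAt ℝ f (samplePoint x σ b r ξ θ) := by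
  have hm : MeasurableSet {y | y ∈ Metric.ball x 1 → DifferentiableAt ℝ f y} :=
    measurableSet_ball.imp (measurableSet_of_differentiableAt ℝ f)
  filter_upwards [ae_of_affine_ray (ae_differentiableAt_of_mem_ball hf) hm x b hr.ne']
    with ξ h hξ
  have hw : 0 < ‖b + r • ξ‖ := norm_pos_iff.2 (add_smul_ne_zero hr hrb hξ)
  -- Once `ξ` is fixed, normalizing the direction only rescales the parameter of the ray.
  have hq : Measure.QuasiMeasurePreserving (fun θ : ℝ => (σ / ‖b + r • ξ‖) • θ)
        volume volume := Measure.quasiMeasurePreserving_smul volume (by positivity)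
  filter_upwards [hq.ae h] with θ h2 hθ
  have h3 : samplePoint x σ b r ξ θ = x - ((σ / ‖b + r • ξ‖) • θ) • (b + r • ξ) := by
    rw [samplePoint, smul_eq_mul, mul_comm]
  rw [h3]
  apply h2
  rw [← h3, mem_ball_iff_norm]
  exact (norm_samplePoint_sub_le hσ0.le b r ξ hθ).trans_lt hσ1

/-! ### The fundamental theorem of calculus along a segment -/

theorem segment_mem_ball (hσ0 : 0 < σ) (hσ1 : σ < 1) {u : E d} (hu : ‖u‖ ≤ 1) {θ : ℝ}
    (hθ : θ ∈ Icc (0 : ℝ) 1) : x - (θ * σ) • u ∈ Metric.ball x 1 := by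
  rw [mem_ball_iff_norm, sub_sub_cancel_left, norm_neg, norm_smul,
    Real.norm_of_nonneg (mul_nonneg hθ.1 hσ0.le)]
  calc θ * σ * ‖u‖ ≤ 1 * σ * 1 := by
        gcongr
        exact hθ.2
    _ < 1 := by linarith

/-- A Lipschitz function of one variable is absolutely continuous, hence the integral of its
derivative. The chain rule needs `f` itself to be differentiable at almost every point of the
segment; a fixed segment may well lie in the exceptional null set. -/
theorem integral_inner_gradient_segment (hf : LipschitzOnWith L f (Metric.ball x 1))
    (hσ0 : 0 < σ) (hσ1 : σ < 1) {u : E d} (hu : ‖u‖ ≤ 1)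
    (hdiff : ∀ᵐ θ : ℝ, θ ∈ Icc (0 : ℝ) 1 → DifferentiableAt ℝ f (x - (θ * σ) • u)) :
    ∫ θ in Icc (0 : ℝ) 1, inner ℝ (gradient f (x - (θ * σ) • u)) u
      = (f x - f (x - σ • u)) / σ := by
  have hlip : LipschitzOnWith (L * ‖σ • u‖₊) (fun θ : ℝ => f (x - (θ * σ) • u))
      (uIcc (0 : ℝ) 1) := by
    rw [uIcc_of_le zero_le_one]
    refine hf.comp (f := fun θ : ℝ => x - (θ * σ) • u) ?_
      (fun θ hθ => segment_mem_ball hσ0 hσ1 hu hθ)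
    refine LipschitzOnWith.of_dist_le_mul fun s _ t _ => le_of_eq ?_
    have h : x - (s * σ) • u - (x - (t * σ) • u) = (t - s) • (σ • u) := by module
    rw [dist_eq_norm, dist_eq_norm, h, norm_smul, norm_sub_rev t s, coe_nnnorm, mul_comm]
  have hftc := hlip.absolutelyContinuousOnInterval.integral_deriv_eq_sub
  rw [intervalIntegral.integral_of_le zero_le_one, ← integral_Icc_eq_integral_Ioc] at hftc
  have hcongr : ∫ θ in Icc (0 : ℝ) 1, deriv (fun θ : ℝ => f (x - (θ * σ) • u)) θ
      = ∫ θ in Icc (0 : ℝ) 1, -σ * inner ℝ (gradient f (x - (θ * σ) • u)) u := by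
    refine setIntegral_congr_ae measurableSet_Icc ?_
    filter_upwards [hdiff] with θ hθ hmem
    have h1 : HasDerivAt (fun θ : ℝ => x - (θ * σ) • u) (-(σ • u)) θ := by
      have := ((((hasDerivAt_id θ).mul_const σ).smul_const u).const_sub x)
      simpa using this
    have h2 := ((hθ hmem).hasFDerivAt.comp_hasDerivAt θ h1).deriv
    change deriv (f ∘ fun θ : ℝ => x - (θ * σ) • u) θ = _
    rw [h2, inner_gradient, map_neg, map_smul, smul_eq_mul, neg_mul]
  rw [hcongr, integral_const_mul] at hftc
  simp only [one_mul, zero_mul, zero_smul, sub_zero] at hftc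
  rw [eq_div_iff hσ0.ne']
  linarith

theorem measurable_gradient (f : E d → ℝ) : Measurable (gradient f) :=
  (LinearIsometryEquiv.continuous _).measurable.comp (measurable_fderiv ℝ f)

theorem integrableOn_inner_gradient (hf : LipschitzOnWith L f (Metric.ball x 1))
    (hσ0 : 0 < σ) (hσ1 : σ < 1) {u : E d} (hu : ‖u‖ ≤ 1) (w : E d) :
    IntegrableOn (fun θ : ℝ => inner ℝ (gradient f (x - (θ * σ) • u)) w) (Icc (0 : ℝ) 1) := by
  refine Measure.integrableOn_of_bounded (M := L * ‖w‖) (by simp) ?_ ?_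
  · refine Measurable.aestronglyMeasurable ?_
    exact ((measurable_gradient f).comp (by fun_prop)).inner_const
  · filter_upwards [self_mem_ae_restrict measurableSet_Icc] with θ hθ
    refine (norm_inner_le_norm _ _).trans ?_
    gcongr
    exact norm_gradient_le hf (segment_mem_ball hσ0 hσ1 hu hθ)

/-- If the step along `b` does not give sufficient descent, then the mean of `⟪∇ f, b⟫` over the
segment along a small perturbation of `b` is at most `‖b‖² / 2`. -/
theorem integral_inner_gradient_le (hf : LipschitzOnWith L f (Metric.ball x 1))
    (hσ0 : 0 < σ) (hσ1 : σ < 1) {b w : E d} (hw : w ≠ 0)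
    (hact : LoopActive f x σ b) (hbσ : √128 * L * σ ≤ ‖b‖)
    (hwb : ‖w - b‖ ≤ σ * ‖b‖)
    (hdiff : ∀ᵐ θ : ℝ, θ ∈ Icc (0 : ℝ) 1 →
      DifferentiableAt ℝ f (x - (θ * σ) • (‖w‖⁻¹ • w))) :
    ∫ θ in Icc (0 : ℝ) 1, inner ℝ (gradient f (x - (θ * σ) • (‖w‖⁻¹ • w))) b
      ≤ ‖b‖ ^ 2 / 2 := by
  have hb0 : 0 < ‖b‖ := hact.1
  set u := ‖w‖⁻¹ • w with hu
  set v := ‖b‖⁻¹ • b with hv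
  have hu1 : ‖u‖ ≤ 1 := norm_normalize_le_one w
  have hv1 : ‖v‖ ≤ 1 := norm_normalize_le_one b
  have huv : ‖u - v‖ ≤ 2 * σ := by
    refine (norm_normalize_sub_le (norm_pos_iff.1 hb0) hw).trans ?_
    rw [div_le_iff₀ hb0]
    linarith
  have hbv : b = ‖b‖ • v := by rw [hv, smul_smul, mul_inv_cancel₀ hb0.ne', one_smul]
  have h1 : ∫ θ in Icc (0 : ℝ) 1, inner ℝ (gradient f (x - (θ * σ) • u)) b
      ≤ ∫ θ in Icc (0 : ℝ) 1, (‖b‖ * inner ℝ (gradient f (x - (θ * σ) • u)) u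
        + ‖b‖ * (L * (2 * σ))) := by
    refine setIntegral_mono_on (integrableOn_inner_gradient hf hσ0 hσ1 hu1 b) ?_
      measurableSet_Icc fun θ hθ => ?_
    · exact ((integrableOn_inner_gradient hf hσ0 hσ1 hu1 u).const_mul _).add
        (integrableOn_const (by simp))
    · have h2 : inner ℝ (gradient f (x - (θ * σ) • u)) b
          = ‖b‖ * inner ℝ (gradient f (x - (θ * σ) • u)) u
            + ‖b‖ * inner ℝ (gradient f (x - (θ * σ) • u)) (v - u) := by
        conv_lhs => rw [hbv]
        rw [inner_smul_right, inner_sub_right]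
        ring
      rw [h2]
      gcongr
      refine (real_inner_le_norm _ _).trans ?_
      rw [norm_sub_rev v u]
      gcongr
      exact norm_gradient_le hf (segment_mem_ball hσ0 hσ1 hu1 hθ)
  have h3 : ∫ θ in Icc (0 : ℝ) 1, (‖b‖ * inner ℝ (gradient f (x - (θ * σ) • u)) u
        + ‖b‖ * (L * (2 * σ))) = ‖b‖ * ((f x - f (x - σ • u)) / σ) + ‖b‖ * (L * (2 * σ)) := by
    rw [integral_add ((integrableOn_inner_gradient hf hσ0 hσ1 hu1 u).const_mul _)
      (integrableOn_const (by simp)), integral_const_mul,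
      integral_inner_gradient_segment hf hσ0 hσ1 hu1 hdiff]
    simp
  have hmem1 : ∀ {u : E d}, ‖u‖ ≤ 1 → x - σ • u ∈ Metric.ball x 1 := fun h => by
    simpa using segment_mem_ball (x := x) hσ0 hσ1 h (θ := 1) (by simp)
  have h4 : f x - f (x - σ • u) ≤ σ / 8 * ‖b‖ + L * (σ * (2 * σ)) := by
    have h5 : normStep x σ b = x - σ • v := by
      rw [normStep, hv, smul_smul, div_eq_mul_inv]
    have h6 := hact.2
    rw [h5] at h6
    have h7 : f (x - σ • v) - f (x - σ • u) ≤ L * (σ * (2 * σ)) := by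
      refine (le_abs_self _).trans ((abs_sub_le_of_mem_ball hf (hmem1 hv1) (hmem1 hu1)).trans ?_)
      have : x - σ • v - (x - σ • u) = σ • (u - v) := by module
      rw [this, norm_smul, Real.norm_of_nonneg hσ0.le]
      gcongr
    linarith
  have h8 : (f x - f (x - σ • u)) / σ ≤ ‖b‖ / 8 + L * (2 * σ) := by
    rw [div_le_iff₀ hσ0]
    linarith
  -- The error is `4 ‖b‖ L σ`, half from changing the direction in the inner product and half from
  -- moving the endpoint. It is at most `4 / 11 ‖b‖²`, and `1 / 8 + 4 / 11 < 1 / 2`.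
  have h9 : (11 : ℝ) ≤ √128 := Real.le_sqrt_of_sq_le (by norm_num)
  have h10 : 11 * ((L : ℝ) * σ) ≤ ‖b‖ := by
    refine le_trans ?_ hbσ
    rw [mul_assoc]
    gcongr
  calc _ ≤ ‖b‖ * ((f x - f (x - σ • u)) / σ) + ‖b‖ * (L * (2 * σ)) := h1.trans h3.le
    _ ≤ ‖b‖ * (‖b‖ / 8 + L * (2 * σ)) + ‖b‖ * (L * (2 * σ)) := by gcongr
    _ = ‖b‖ ^ 2 / 8 + 4 * ‖b‖ * (L * σ) := by ring
    _ ≤ ‖b‖ ^ 2 / 8 + 4 * ‖b‖ * (‖b‖ / 11) := by gcongr; linarith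
    _ ≤ ‖b‖ ^ 2 / 2 := by nlinarith [sq_nonneg ‖b‖]

/-- The mean over the segment of the factor by which the potential decreases. -/
theorem lintegral_factor_le (hf : LipschitzOnWith L f (Metric.ball x 1))
    (hσ0 : 0 < σ) (hσ1 : σ < 1) {b ξ : E d} {r M : ℝ} (hr : 0 < r) (hrb : r < σ * ‖b‖)
    (hξ : ‖ξ‖ < 1) (hact : LoopActive f x σ b) (hM : √128 * L * σ ≤ M) (hM0 : 0 < M)
    (hMb : M < ‖b‖) (hbL : ‖b‖ ≤ L)
    (hdiff : ∀ᵐ θ : ℝ, θ ∈ Icc (0 : ℝ) 1 → DifferentiableAt ℝ f (samplePoint x σ b r ξ θ)) :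
    ∫⁻ θ in Icc (0 : ℝ) 1, ENNReal.ofReal (1 - M ^ 2 / (8 * L ^ 2) *
        (3 / 4 - inner ℝ b (gradient f (samplePoint x σ b r ξ θ)) / ‖b‖ ^ 2))
      ≤ ENNReal.ofReal (1 - M ^ 2 / (32 * L ^ 2)) := by
  have hb0 : 0 < ‖b‖ := hact.1
  have hL0 : (0 : ℝ) < L := hb0.trans_le hbL
  have hrb' : r < ‖b‖ := hrb.trans_le (mul_le_of_le_one_left hb0.le hσ1.le)
  set w := b + r • ξ with hw
  have hw0 : w ≠ 0 := add_smul_ne_zero hr hrb' hξ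
  have hwb : ‖w - b‖ ≤ σ * ‖b‖ := by
    rw [hw, add_sub_cancel_left, norm_smul, Real.norm_of_nonneg hr.le]
    nlinarith [norm_nonneg ξ]
  simp only [samplePoint_eq] at hdiff ⊢
  rw [← hw] at hdiff ⊢
  have hI := integral_inner_gradient_le hf hσ0 hσ1 hw0 hact (hM.trans hMb.le) hwb hdiff
  have hu1 := norm_normalize_le_one w
  have hint := integrableOn_inner_gradient hf hσ0 hσ1 hu1 b
  simp only [real_inner_comm _ b]
  set q : ℝ → ℝ := fun θ => inner ℝ (gradient f (x - (θ * σ) • ‖w‖⁻¹ • w)) b with hq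
  change ∫⁻ θ in Icc (0 : ℝ) 1, ENNReal.ofReal
    (1 - M ^ 2 / (8 * L ^ 2) * (3 / 4 - q θ / ‖b‖ ^ 2)) ≤ _
  have hci : IntegrableOn (fun θ => 3 / 4 - q θ / ‖b‖ ^ 2) (Icc (0 : ℝ) 1) :=
    (integrable_const _).sub (hint.div_const _)
  rw [← ofReal_integral_eq_lintegral_ofReal]
  · apply ENNReal.ofReal_le_ofReal
    rw [integral_sub (integrable_const _) (hci.const_mul _), integral_const_mul,
      integral_sub (integrable_const _) (hint.div_const _), integral_div (‖b‖ ^ 2) q]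
    simp only [integral_const, MeasurableSet.univ, measureReal_restrict_apply, univ_inter,
      Real.volume_real_Icc_of_le zero_le_one, sub_zero, smul_eq_mul, one_mul]
    have h1 : (∫ θ in Icc (0 : ℝ) 1, q θ) / ‖b‖ ^ 2 ≤ 1 / 2 := by
      rw [div_le_iff₀ (by positivity)]
      linarith
    -- The margin `3 / 4 - 1 / 2 = 1 / 4` turns the `8` into the `32` of the rate.
    have h2 : M ^ 2 / (8 * (L : ℝ) ^ 2) * (1 / 4)
        ≤ M ^ 2 / (8 * L ^ 2) * (3 / 4 - (∫ θ in Icc (0 : ℝ) 1, q θ) / ‖b‖ ^ 2) := by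
      gcongr
      linarith
    have h3 : M ^ 2 / (8 * (L : ℝ) ^ 2) * (1 / 4) = M ^ 2 / (32 * L ^ 2) := by
      field_simp; norm_num
    linarith
  · exact (integrable_const _).sub (hci.const_mul _)
  -- The factor is nonnegative because `M < ‖b‖ ≤ L`, so `ENNReal.ofReal` truncates nothing.
  · filter_upwards [self_mem_ae_restrict measurableSet_Icc] with θ hθ
    have h1 : |q θ| ≤ L * ‖b‖ := (abs_real_inner_le_norm _ _).trans (by
      gcongr
      exact norm_gradient_le hf (segment_mem_ball hσ0 hσ1 hu1 hθ))
    have h2 : 3 / 4 - q θ / ‖b‖ ^ 2 ≤ 2 * L / ‖b‖ := by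
      have h3 : -(q θ / ‖b‖ ^ 2) ≤ L / ‖b‖ := by
        rw [← neg_div, div_le_div_iff₀ (by positivity) hb0]
        nlinarith [neg_abs_le (q θ)]
      have h4 : 1 ≤ L / ‖b‖ := (one_le_div hb0).2 hbL
      rw [mul_div_assoc]
      linarith
    have h5 : M ^ 2 / (8 * (L : ℝ) ^ 2) * (3 / 4 - q θ / ‖b‖ ^ 2) ≤ 1 := by
      calc _ ≤ M ^ 2 / (8 * (L : ℝ) ^ 2) * (2 * L / ‖b‖) := by gcongr
        _ = (M * M) / (4 * (L * ‖b‖)) := by field_simp; norm_num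
        _ ≤ 1 := by
          rw [div_le_one (by positivity)]
          have : M * M ≤ L * ‖b‖ := by
            gcongr
            exact hMb.le.trans hbL
          nlinarith [mul_pos hL0 hb0]
    simpa using h5

/-! ### One step of normal descent decreases the expected potential -/

/-- The states in which the loop of normal descent is active and its vector is longer than `M`. -/
def Critical (f : E d → ℝ) (x₀ : E d) (L : NNReal) (σ M : ℝ) (x b : E d) : Prop :=
  f x ≤ f x₀ ∧ LoopActive f x σ b ∧ M < ‖b‖ ∧ ‖b‖ ≤ L

open Classical in
/-- The potential `exp (-M² / ‖b‖²)`, restricted to the critical states. -/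
noncomputable def potential (f : E d → ℝ) (x₀ : E d) (L : NNReal) (σ M : ℝ) (x b : E d) :
    ENNReal :=
  if Critical f x₀ L σ M x b then ENNReal.ofReal (Real.exp (-(M ^ 2 / ‖b‖ ^ 2))) else 0

theorem measurableSet_critical (hf : Continuous f) (x₀ : E d) (L : NNReal) (σ M : ℝ) :
    MeasurableSet {p : E d × E d | Critical f x₀ L σ M p.1 p.2} := by
  have hfm : Measurable f := hf.measurable
  have h1 : MeasurableSet {p : E d × E d | f p.1 ≤ f x₀} :=
    measurableSet_le (by fun_prop) (by fun_prop)
  have h2 : MeasurableSet {p : E d × E d | 0 < ‖p.2‖} :=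
    measurableSet_lt (by fun_prop) (by fun_prop)
  have h3 : MeasurableSet {p : E d × E d | f p.1 - f (normStep p.1 σ p.2) ≤ σ / 8 * ‖p.2‖} := by
    unfold normStep
    refine measurableSet_le ?_ (by fun_prop)
    exact (hfm.comp measurable_fst).sub (hfm.comp (by fun_prop))
  have h4 : MeasurableSet {p : E d × E d | M < ‖p.2‖} :=
    measurableSet_lt (by fun_prop) (by fun_prop)
  have h5 : MeasurableSet {p : E d × E d | ‖p.2‖ ≤ L} :=
    measurableSet_le (by fun_prop) (by fun_prop)
  exact h1.inter ((h2.inter h3).inter (h4.inter h5))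

theorem measurable_potential (hf : Continuous f) (x₀ : E d) (L : NNReal) (σ M : ℝ) :
    Measurable fun p : E d × E d => potential f x₀ L σ M p.1 p.2 := by
  unfold potential
  exact Measurable.ite (measurableSet_critical hf x₀ L σ M) (by fun_prop) measurable_const

theorem measurable_samplePoint (σ : ℝ) :
    Measurable fun w : (E d × E d × ℝ) × E d × ℝ =>
      samplePoint w.1.1 σ w.1.2.1 w.1.2.2 w.2.1 w.2.2 := by
  unfold samplePoint
  fun_prop

theorem map_eq_restrict_of_isUniform_Icc {Ω : Type*} [MeasurableSpace Ω] {μ : Measure Ω} {θ : Ω → ℝ}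
    (h : pdf.IsUniform θ (Icc (0 : ℝ) 1) μ volume) :
    Measure.map θ μ = volume.restrict (Icc (0 : ℝ) 1) := by
  rw [pdf.IsUniform] at h
  rw [h, ProbabilityTheory.cond]
  simp

-- Independence makes the joint law of past state and draws a product measure. By Tonelli the past
-- can then be frozen and `lintegral_factor_le` applied to the draws, without conditional
-- expectations. Since criticality after the step forces it before, only critical past states
-- contribute.
set_option maxHeartbeats 400000 in
theorem lintegral_potential_step {Ω : Type*} {m mΩ : MeasurableSpace Ω} {μ : Measure Ω}
    [IsProbabilityMeasure μ] (hm : m ≤ mΩ) (hfc : Continuous f)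
    (hf : ∀ x, f x ≤ f x₀ → LipschitzOnWith L f (Metric.ball x 1))
    (hσ0 : 0 < σ) (hσ1 : σ < 1) {M : ℝ} (hM : √128 * L * σ ≤ M) (hM0 : 0 < M)
    {X B B' ξ h : Ω → E d} {r θ : Ω → ℝ}
    (hX : Measurable[m] X) (hB : Measurable[m] B) (hr : Measurable[m] r)
    (hξ : Measurable[mΩ] ξ) (hθ : Measurable[mΩ] θ)
    (hξu : pdf.IsUniform ξ (Metric.ball (0 : E d) 1) μ volume)
    (hθu : pdf.IsUniform θ (Icc (0 : ℝ) 1) μ volume)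
    (hind : IndepFun ξ θ μ)
    (hpast : Indep (MeasurableSpace.comap (fun ω => (ξ ω, θ ω)) inferInstance) m μ)
    (hloop : ∀ ω, LoopActive f (X ω) σ (B ω) →
      0 < r ω ∧ r ω < σ * ‖B ω‖ ∧ IsMinNormOnSegment (B ω) (h ω) (B' ω))
    (hgrad : ∀ᵐ ω ∂μ, LoopActive f (X ω) σ (B ω) →
      DifferentiableAt ℝ f (samplePoint (X ω) σ (B ω) (r ω) (ξ ω) (θ ω)) →
      h ω = gradient f (samplePoint (X ω) σ (B ω) (r ω) (ξ ω) (θ ω)))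
    (hsub : ∀ᵐ ω ∂μ, Critical f x₀ L σ M (X ω) (B' ω) → Critical f x₀ L σ M (X ω) (B ω)) :
    ∫⁻ ω, potential f x₀ L σ M (X ω) (B' ω) ∂μ
      ≤ ENNReal.ofReal (1 - M ^ 2 / (32 * L ^ 2)) *
        ∫⁻ ω, potential f x₀ L σ M (X ω) (B ω) ∂μ := by
  classical
  set P : Ω → E d × E d × ℝ := fun ω => (X ω, B ω, r ω) with hP
  set Q : Ω → E d × ℝ := fun ω => (ξ ω, θ ω) with hQ
  have hPm' : Measurable[m] P := hX.prodMk (hB.prodMk hr)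
  have hPm : Measurable[mΩ] P := hPm'.mono hm le_rfl
  have hQm : Measurable[mΩ] Q := hξ.prodMk hθ
  have hPQ : Measure.map (fun ω => (P ω, Q ω)) μ
      = (Measure.map P μ).prod ((Measure.map ξ μ).prod (Measure.map θ μ)) := by
    have h1 : IndepFun P Q μ :=
      (indep_of_indep_of_le_right hpast hPm'.comap_le).symm
    rw [(indepFun_iff_map_prod_eq_prod_map_map hPm.aemeasurable hQm.aemeasurable).1 h1,
      (indepFun_iff_map_prod_eq_prod_map_map hξ.aemeasurable hθ.aemeasurable).1 hind]
  have hθmap := map_eq_restrict_of_isUniform_Icc hθu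
  have hξball : ∀ᵐ ξ' ∂(Measure.map ξ μ), ‖ξ'‖ < 1 := by
    rw [pdf.IsUniform] at hξu
    rw [hξu]
    filter_upwards [ae_cond_mem measurableSet_ball] with w hw
    simpa using hw
  have hprobξ : IsProbabilityMeasure (Measure.map ξ μ) :=
    Measure.isProbabilityMeasure_map hξ.aemeasurable
  have hprobθ : IsProbabilityMeasure (Measure.map θ μ) :=
    Measure.isProbabilityMeasure_map hθ.aemeasurable
  have hprobP : IsProbabilityMeasure (Measure.map P μ) :=
    Measure.isProbabilityMeasure_map hPm.aemeasurable
  set Good : E d × E d × ℝ → Prop := fun p =>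
    Critical f x₀ L σ M p.1 p.2.1 ∧ 0 < p.2.2 ∧ p.2.2 < σ * ‖p.2.1‖ with hGood
  have hGm : MeasurableSet {p | Good p} := by
    have h1 : MeasurableSet {p : E d × E d × ℝ | 0 < p.2.2} :=
      measurableSet_lt (by fun_prop) (by fun_prop)
    have h2 : MeasurableSet {p : E d × E d × ℝ | p.2.2 < σ * ‖p.2.1‖} :=
      measurableSet_lt (by fun_prop) (by fun_prop)
    refine MeasurableSet.inter ?_ (h1.inter h2)
    exact (by fun_prop : Measurable fun p : E d × E d × ℝ => (p.1, p.2.1))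
      (measurableSet_critical hfc x₀ L σ M)
  set S : (E d × E d × ℝ) × E d × ℝ → E d :=
    fun w => samplePoint w.1.1 σ w.1.2.1 w.1.2.2 w.2.1 w.2.2 with hS
  have hSm : Measurable S := measurable_samplePoint σ
  have hdiff : ∀ p, Good p → ∀ᵐ ξ' ∂(Measure.map ξ μ), ∀ᵐ θ' : ℝ, θ' ∈ Icc (0 : ℝ) 1 →
      DifferentiableAt ℝ f (S (p, ξ', θ')) := by
    intro p hp
    have hb : p.2.2 < ‖p.2.1‖ :=
      hp.2.2.trans_le (mul_le_of_le_one_left (norm_nonneg _) hσ1.le)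
    filter_upwards [hξu.absolutelyContinuous.ae_le
      (ae_differentiableAt_samplePoint (hf _ hp.1.1) hσ0 hσ1 hp.2.1 hb), hξball] with w h1 h2
    exact h1 h2
  -- Almost sure differentiability at the sampled point is what forces the chosen subgradient `h` to
  -- be the gradient, hence a function of past and draws.
  have hdiffω : ∀ᵐ ω ∂μ, Good (P ω) → DifferentiableAt ℝ f (S (P ω, Q ω)) := by
    have hmeas : MeasurableSet {w : (E d × E d × ℝ) × E d × ℝ |
        Good w.1 → DifferentiableAt ℝ f (S w)} :=
      (measurable_fst hGm).imp (hSm (measurableSet_of_differentiableAt ℝ f))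
    refine (ae_map_iff (hPm.prodMk hQm).aemeasurable hmeas).1 ?_
    rw [hPQ, Measure.ae_prod_iff_ae_ae hmeas]
    refine ae_of_all _ fun p => ?_
    by_cases hp : Good p
    · refine (Measure.ae_prod_iff_ae_ae (measurable_prodMk_left hmeas)).2 ?_
      filter_upwards [hdiff p hp] with ξ' h1
      rw [hθmap]
      filter_upwards [ae_restrict_of_ae h1, self_mem_ae_restrict measurableSet_Icc] with θ' h2 h3 _
      exact h2 h3
    · exact ae_of_all _ fun _ h1 => absurd h1 hp
  have hθω : ∀ᵐ ω ∂μ, θ ω ∈ Icc (0 : ℝ) 1 := by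
    refine (ae_map_iff hθ.aemeasurable measurableSet_Icc).1 ?_
    rw [hθmap]
    exact self_mem_ae_restrict measurableSet_Icc
  set F : (E d × E d × ℝ) × E d × ℝ → ENNReal := fun w =>
    (if Good w.1 then ENNReal.ofReal (Real.exp (-(M ^ 2 / ‖w.1.2.1‖ ^ 2))) else 0) *
      ENNReal.ofReal (1 - M ^ 2 / (8 * L ^ 2) *
        (3 / 4 - inner ℝ w.1.2.1 (gradient f (S w)) / ‖w.1.2.1‖ ^ 2)) with hF
  have hinner : Measurable fun w => inner ℝ w.1.2.1 (gradient f (S w)) :=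
    Measurable.inner (by fun_prop) ((measurable_gradient f).comp hSm)
  have hψm : Measurable fun w : (E d × E d × ℝ) × E d × ℝ =>
      ENNReal.ofReal (1 - M ^ 2 / (8 * L ^ 2) *
        (3 / 4 - inner ℝ w.1.2.1 (gradient f (S w)) / ‖w.1.2.1‖ ^ 2)) := by
    refine ENNReal.measurable_ofReal.comp ?_
    exact measurable_const.sub (measurable_const.mul
      (measurable_const.sub (hinner.div (by fun_prop))))
  have hFm : Measurable F :=
    (Measurable.ite (measurable_fst hGm) (by fun_prop) measurable_const).mul hψm
  have hle : ∀ᵐ ω ∂μ, potential f x₀ L σ M (X ω) (B' ω) ≤ F (P ω, Q ω) := by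
    filter_upwards [hgrad, hsub, hdiffω, hθω] with ω h1 h2 h3 h4
    rw [potential]
    split_ifs with hc
    · have hcB := h2 hc
      obtain ⟨hr0, hr1, hmin⟩ := hloop ω hcB.2.1
      have hg : Good (P ω) := ⟨hcB, hr0, hr1⟩
      have hh := h1 hcB.2.1 (h3 hg)
      have hhL : ‖h ω‖ ≤ L := by
        rw [hh]
        refine norm_gradient_le (hf _ hcB.1) ?_
        rw [mem_ball_iff_norm]
        exact (norm_samplePoint_sub_le hσ0.le _ _ _ h4).trans_lt hσ1
      have := exp_potential_le (L := L) hmin hM0 hcB.2.2.1 hcB.2.2.2 hhL hc.2.2.1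
      rw [hF]
      simp only [if_pos hg]
      rw [← ENNReal.ofReal_mul (Real.exp_pos _).le]
      refine ENNReal.ofReal_le_ofReal ?_
      rw [hh] at this
      exact this
    · exact zero_le
  calc ∫⁻ ω, potential f x₀ L σ M (X ω) (B' ω) ∂μ ≤ ∫⁻ ω, F (P ω, Q ω) ∂μ :=
        lintegral_mono_ae hle
    _ = ∫⁻ w, F w ∂((Measure.map P μ).prod ((Measure.map ξ μ).prod (Measure.map θ μ))) := by
        rw [← hPQ, lintegral_map hFm (hPm.prodMk hQm)]
    _ = ∫⁻ p, ∫⁻ q, F (p, q) ∂((Measure.map ξ μ).prod (Measure.map θ μ)) ∂(Measure.map P μ) :=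
        lintegral_prod _ hFm.aemeasurable
    _ ≤ ∫⁻ p, ENNReal.ofReal (1 - M ^ 2 / (32 * L ^ 2)) * potential f x₀ L σ M p.1 p.2.1
          ∂(Measure.map P μ) := by
        refine lintegral_mono fun p => ?_
        by_cases hp : Good p
        · simp only [hF, if_pos hp]
          have hψp : Measurable fun q : E d × ℝ => ENNReal.ofReal (1 - M ^ 2 / (8 * L ^ 2) *
              (3 / 4 - inner ℝ p.2.1 (gradient f (S (p, q))) / ‖p.2.1‖ ^ 2)) :=
            hψm.comp measurable_prodMk_left
          rw [lintegral_const_mul _ hψp, potential, if_pos hp.1,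
            mul_comm (ENNReal.ofReal (1 - _))]
          gcongr
          rw [lintegral_prod _ hψp.aemeasurable]
          refine (lintegral_mono_ae (g := fun _ => ENNReal.ofReal (1 - M ^ 2 / (32 * L ^ 2)))
            ?_).trans (le_of_eq (by rw [lintegral_const, measure_univ, mul_one]))
          filter_upwards [hdiff p hp, hξball] with ξ' h1 h2
          rw [hθmap]
          exact lintegral_factor_le (x := p.1) (b := p.2.1) (ξ := ξ') (r := p.2.2) (M := M) (hf _ hp.1.1) hσ0 hσ1 hp.2.1 hp.2.2 h2 hp.1.2.1 hM hM0
            hp.1.2.2.1 hp.1.2.2.2 h1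
        · simp [hF, if_neg hp]
    _ = _ := by
        have hpm : Measurable fun p : E d × E d × ℝ => potential f x₀ L σ M p.1 p.2.1 :=
          (measurable_potential hfc x₀ L σ M).comp
            (by fun_prop : Measurable fun p : E d × E d × ℝ => (p.1, p.2.1))
        rw [lintegral_const_mul _ hpm, lintegral_map hpm hPm]

/-- Markov's inequality: on a critical state `M < ‖b‖`, so the potential is at least `e⁻¹`. -/
theorem ofReal_exp_mul_measure_critical_le {Ω : Type*} [MeasurableSpace Ω] {μ : Measure Ω}
    {M : ℝ} (hM0 : 0 < M) (X B : Ω → E d) (hc : MeasurableSet {ω | Critical f x₀ L σ M (X ω) (B ω)}) :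
    ENNReal.ofReal (Real.exp (-1)) * μ {ω | Critical f x₀ L σ M (X ω) (B ω)}
      ≤ ∫⁻ ω, potential f x₀ L σ M (X ω) (B ω) ∂μ := by
  rw [← lintegral_indicator_const hc]
  refine lintegral_mono (indicator_le fun ω hω => ?_)
  have hω : Critical f x₀ L σ M (X ω) (B ω) := hω
  rw [potential, if_pos hω]
  refine ENNReal.ofReal_le_ofReal (Real.exp_le_exp.2 (neg_le_neg ?_))
  have hb := hM0.trans hω.2.2.1
  rw [div_le_one (by positivity)]
  exact pow_le_pow_left₀ hM0.le hω.2.2.1.le 2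

theorem potential_le_one (x b : E d) (M : ℝ) : potential f x₀ L σ M x b ≤ 1 := by
  rw [potential]
  split_ifs
  · rw [ENNReal.ofReal_le_one, Real.exp_le_one_iff, neg_nonpos]
    positivity
  · exact zero_le_one

/-! ### Grid radii -/

theorem gridRadius_pos (G i : ℕ) : 0 < gridRadius G i := by
  rw [gridRadius]; positivity

theorem gridRadius_succ (G i : ℕ) : gridRadius G (i + 1) = 2 * gridRadius G i := by
  rw [gridRadius, gridRadius, ← zpow_one_add₀ two_ne_zero]
  congr 1
  push_cast
  ring

theorem gridRadius_self (G : ℕ) : gridRadius G G = 1 := by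
  simp [gridRadius]

theorem gridRadius_mono (G : ℕ) : Monotone (gridRadius G) :=
  monotone_nat_of_le_succ fun i => by
    rw [gridRadius_succ]
    linarith [gridRadius_pos G i]

theorem gridRadius_lt_one {G i : ℕ} (h : i < G) : gridRadius G i < 1 := by
  have h1 := gridRadius_mono G (Nat.succ_le_of_lt h)
  rw [gridRadius_self, Nat.succ_eq_add_one, gridRadius_succ] at h1
  linarith [gridRadius_pos G i]

theorem gridRadius_add_sub {G G' : ℕ} (h : G ≤ G') (i : ℕ) :
    gridRadius G' (i + (G' - G)) = gridRadius G i := by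
  rw [gridRadius, gridRadius]
  congr 1
  push_cast [h]
  ring

theorem one_eighth_le_gridRadius {G i : ℕ} (h : G ≤ i + 3) : 1 / 8 ≤ gridRadius G i := by
  rw [gridRadius, show (1 / 8 : ℝ) = (2 : ℝ) ^ (-3 : ℤ) by norm_num]
  exact zpow_le_zpow_right₀ one_le_two (by omega)

/-! ### The inner loops stay in the Goldstein subdifferential -/

theorem IsTDescentRun.mem_goldstein {T : ℕ} {g : E d} {a : ℕ → E d}
    (h : IsTDescentRun f x σ T g a) (hσ : 0 ≤ σ) (hg : g ∈ goldstein f σ x) :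
    ∀ t ≤ T, a t ∈ goldstein f σ x := by
  intro t
  induction t with
  | zero => intro _; rw [h.1]; exact hg
  | succ t ih =>
    intro ht
    have iht := ih (by omega)
    obtain ⟨h1, h2⟩ := h.2 t (by omega)
    by_cases hact : LoopActive f x σ (a t)
    · obtain ⟨w, hw, hmin⟩ := h1 hact
      exact hmin.mem_of_convex (convex_convexHull ℝ _) iht
        (clarke_subset_goldstein (norm_normStep_sub_le hσ _) hw)
    · rw [h2 hact]; exact iht

theorem IsNDescentRun.mem_goldstein {T : ℕ} {g : E d} {b ξ h : ℕ → E d} {r θ : ℕ → ℝ}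
    (hrun : IsNDescentRun f x σ T g b r ξ θ h) (hσ : 0 ≤ σ)
    (hθ : ∀ t < T, θ t ∈ Icc (0 : ℝ) 1) (hg : g ∈ goldstein f σ x) :
    ∀ t ≤ T, b t ∈ goldstein f σ x := by
  intro t
  induction t with
  | zero => intro _; rw [hrun.1]; exact hg
  | succ t ih =>
    intro ht
    have iht := ih (by omega)
    obtain ⟨h1, h2⟩ := hrun.2 t (by omega)
    by_cases hact : LoopActive f x σ (b t)
    · obtain ⟨-, -, hh, hmin⟩ := h1 hact
      exact hmin.mem_of_convex (convex_convexHull ℝ _) iht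
        (clarke_subset_goldstein (norm_samplePoint_sub_le hσ _ _ _ (hθ t (by omega))) hh)
    · rw [h2 hact]; exact iht

/-- Norms never increase along the loop, and an inactive state persists. So a call that has left the
critical states does not return to them. -/
theorem IsNDescentRun.critical_of_succ {T : ℕ} {g : E d} {b ξ h : ℕ → E d} {r θ : ℕ → ℝ}
    (hrun : IsNDescentRun f x σ T g b r ξ θ h) {M : ℝ} {t : ℕ} (ht : t < T) (hb : ‖b t‖ ≤ L)
    (hc : Critical f x₀ L σ M x (b (t + 1))) : Critical f x₀ L σ M x (b t) := by
  obtain ⟨h1, h2⟩ := hrun.2 t ht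
  by_cases hact : LoopActive f x σ (b t)
  · exact ⟨hc.1, hact, hc.2.2.1.trans_le (h1 hact).2.2.2.norm_le, hb⟩
  · rwa [h2 hact] at hc

/-! ### Trajectories of the algorithm -/

namespace Run

variable {Ω : Type*} [mΩ : MeasurableSpace Ω] {μ : Measure Ω} {g₀ : E d} {c₀ : ℝ} {Gs Ts : ℕ → ℕ}
  (R : Run μ f x₀ g₀ c₀ Gs Ts)

theorem f_x_succ_le (k : ℕ) (ω : Ω) : f (R.x (k + 1) ω) ≤ f (R.x k ω) :=
  R.x_succ_le k ω _ (Or.inl rfl)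

theorem f_x_antitone (ω : Ω) : Antitone fun k => f (R.x k ω) :=
  antitone_nat_of_succ_le fun k => R.f_x_succ_le k ω

theorem f_x_le (k : ℕ) (ω : Ω) : f (R.x k ω) ≤ f x₀ := by
  have := R.f_x_antitone ω (Nat.zero_le k)
  simpa [R.x_zero] using this

/-- All draws from the unit interval indeed lie in the unit interval. -/
def DrawsMem (ω : Ω) : Prop :=
  ∀ k, ∀ i < Gs k, ∀ t < Ts k, R.θ k i t ω ∈ Icc (0 : ℝ) 1

theorem measurable_θ {k i t : ℕ} (hi : i < Gs k) (ht : t < Ts k) : Measurable (R.θ k i t) :=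
  (R.θ_adapted k i hi t ht).mono (R.hist.le _) le_rfl

theorem measurable_ξ {k i t : ℕ} (hi : i < Gs k) (ht : t < Ts k) : Measurable (R.ξ k i t) :=
  (R.ξ_adapted k i hi t ht).mono (R.hist.le _) le_rfl

theorem ae_drawsMem : ∀ᵐ ω ∂μ, R.DrawsMem ω := by
  simp only [DrawsMem, ae_all_iff]
  intro k i hi t ht
  refine (ae_map_iff (R.measurable_θ hi ht).aemeasurable measurableSet_Icc).1 ?_
  rw [map_eq_restrict_of_isUniform_Icc (R.θ_uniform k i hi t ht)]
  exact self_mem_ae_restrict measurableSet_Icc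

/-- The radii increase along the grid, so the Goldstein subdifferentials are nested and the vector
handed over by one radius is a legitimate start for the next. -/
theorem v_mem_goldstein {ω : Ω} (hω : R.DrawsMem ω) (k : ℕ) :
    ∀ i < Gs k, R.v k i ω ∈ goldstein f (gridRadius (Gs k) i) (R.x k ω) := by
  intro i
  induction i with
  | zero =>
    intro _
    rw [R.v_zero]
    exact clarke_subset_goldstein (by simpa using (gridRadius_pos _ _).le) (R.g_mem k ω)
  | succ i ih =>
    intro hi
    have hi' : i < Gs k := by omega
    rw [R.v_succ k i hi']
    refine goldstein_mono (gridRadius_mono _ (Nat.le_succ i)) ?_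
    exact (R.normal k i hi' ω).mem_goldstein (gridRadius_pos _ _).le (hω k i hi')
      ((R.tangent k i hi' ω).mem_goldstein (gridRadius_pos _ _).le (ih hi') _ le_rfl) _ le_rfl

theorem b_mem_goldstein {ω : Ω} (hω : R.DrawsMem ω) {k i t : ℕ} (hi : i < Gs k) (ht : t ≤ Ts k) :
    R.b k i t ω ∈ goldstein f (gridRadius (Gs k) i) (R.x k ω) :=
  (R.normal k i hi ω).mem_goldstein (gridRadius_pos _ _).le (hω k i hi)
    ((R.tangent k i hi ω).mem_goldstein (gridRadius_pos _ _).le (R.v_mem_goldstein hω k i hi)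
      _ le_rfl) _ ht

theorem stage_le (k i t : ℕ) : stage k 0 0 ≤ stage k i t := by
  rw [stage, stage, Prod.Lex.toLex_le_toLex]
  refine Or.inr ⟨rfl, ?_⟩
  rw [Prod.Lex.toLex_le_toLex]
  rcases Nat.eq_zero_or_pos i with h | h
  · exact Or.inr ⟨h.symm, Nat.zero_le _⟩
  · exact Or.inl h

variable [IsProbabilityMeasure μ]

theorem lintegral_potential_succ_le (hfc : Continuous f)
    (hf : ∀ x, f x ≤ f x₀ → LipschitzOnWith L f (Metric.ball x 1)) {k i t : ℕ} (hi : i < Gs k)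
    (ht : t < Ts k) {M : ℝ} (hM : √128 * L * gridRadius (Gs k) i ≤ M) (hM0 : 0 < M) :
    ∫⁻ ω, potential f x₀ L (gridRadius (Gs k) i) M (R.x k ω) (R.b k i (t + 1) ω) ∂μ
      ≤ ENNReal.ofReal (1 - M ^ 2 / (32 * L ^ 2)) *
        ∫⁻ ω, potential f x₀ L (gridRadius (Gs k) i) M (R.x k ω) (R.b k i t ω) ∂μ := by
  refine lintegral_potential_step (R.hist.le (stage k i t)) hfc hf (gridRadius_pos _ _)
    (gridRadius_lt_one hi) hM hM0
    ((R.x_adapted k).mono (R.hist.mono (stage_le k i t)) le_rfl)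
    (R.b_adapted k i hi t ht.le) (R.r_adapted k i hi t ht)
    (R.measurable_ξ hi ht) (R.measurable_θ hi ht) (R.ξ_uniform k i hi t ht)
    (R.θ_uniform k i hi t ht) (R.ξ_indep_θ k i hi t ht) (R.draws_indep_past k i hi t ht)
    (h := R.h k i t) ?_ (R.h_eq_gradient k i hi t ht) ?_
  · intro ω hact
    obtain ⟨h1, h2, -, h3⟩ := ((R.normal k i hi ω).2 t ht).1 hact
    exact ⟨h1, h2, h3⟩
  · filter_upwards [R.ae_drawsMem] with ω hω hc
    refine (R.normal k i hi ω).critical_of_succ ht ?_ hc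
    exact norm_le_of_mem_goldstein (hf _ (R.f_x_le k ω)) (gridRadius_lt_one hi)
      (R.b_mem_goldstein hω hi ht.le)

theorem lintegral_potential_le (hfc : Continuous f)
    (hf : ∀ x, f x ≤ f x₀ → LipschitzOnWith L f (Metric.ball x 1)) {k i : ℕ} (hi : i < Gs k)
    {M : ℝ} (hM : √128 * L * gridRadius (Gs k) i ≤ M) (hM0 : 0 < M) :
    ∀ t ≤ Ts k, ∫⁻ ω, potential f x₀ L (gridRadius (Gs k) i) M (R.x k ω) (R.b k i t ω) ∂μ
      ≤ ENNReal.ofReal (1 - M ^ 2 / (32 * L ^ 2)) ^ t := by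
  intro t
  induction t with
  | zero =>
    intro _
    rw [pow_zero]
    refine (lintegral_mono fun ω => potential_le_one _ _ _).trans ?_
    simp
  | succ t ih =>
    intro ht
    rw [pow_succ']
    refine (R.lintegral_potential_succ_le hfc hf hi (by omega) hM hM0).trans ?_
    gcongr
    exact ih (by omega)

/-- The probability that a call of normal descent ends in a critical state. -/
theorem measure_critical_le (hfc : Continuous f)
    (hf : ∀ x, f x ≤ f x₀ → LipschitzOnWith L f (Metric.ball x 1)) {k i : ℕ} (hi : i < Gs k)
    {M : ℝ} (hM : √128 * L * gridRadius (Gs k) i ≤ M) (hM0 : 0 < M) :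
    μ {ω | Critical f x₀ L (gridRadius (Gs k) i) M (R.x k ω) (R.b k i (Ts k) ω)}
      ≤ ENNReal.ofReal (Real.exp (1 - Ts k * (M ^ 2 / (32 * L ^ 2)))) := by
  have hc : MeasurableSet
      {ω | Critical f x₀ L (gridRadius (Gs k) i) M (R.x k ω) (R.b k i (Ts k) ω)} :=
    (((R.x_adapted k).mono (R.hist.le _) le_rfl).prodMk
      ((R.b_adapted k i hi _ le_rfl).mono (R.hist.le _) le_rfl))
      (measurableSet_critical hfc x₀ L _ M)
  have h1 := (ofReal_exp_mul_measure_critical_le hM0 (R.x k) (R.b k i (Ts k)) hc).trans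
    (R.lintegral_potential_le hfc hf hi hM hM0 (Ts k) le_rfl)
  have h2 : ENNReal.ofReal (1 - M ^ 2 / (32 * L ^ 2)) ^ Ts k
      ≤ ENNReal.ofReal (Real.exp (-(Ts k * (M ^ 2 / (32 * L ^ 2))))) := by
    rw [← mul_neg, Real.exp_nat_mul, ENNReal.ofReal_pow (Real.exp_pos _).le]
    gcongr
    linarith [Real.add_one_le_exp (-(M ^ 2 / (32 * (L : ℝ) ^ 2)))]
  calc _ = ENNReal.ofReal (Real.exp 1) * (ENNReal.ofReal (Real.exp (-1)) *
        μ {ω | Critical f x₀ L (gridRadius (Gs k) i) M (R.x k ω) (R.b k i (Ts k) ω)}) := by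
        rw [← mul_assoc, ← ENNReal.ofReal_mul (Real.exp_pos _).le, ← Real.exp_add]
        simp
    _ ≤ ENNReal.ofReal (Real.exp 1) *
        ENNReal.ofReal (Real.exp (-(Ts k * (M ^ 2 / (32 * L ^ 2))))) := by
        gcongr
        exact h1.trans h2
    _ = _ := by
        rw [← ENNReal.ofReal_mul (Real.exp_pos _).le, ← Real.exp_add, sub_eq_add_neg]

end Run

/-! ### Subgradient inequalities for convex functions -/

theorem inner_gradient_le_of_convexOn (hf : ConvexOn ℝ univ f) (hd : DifferentiableAt ℝ f y)
    (z : E d) : f y + inner ℝ (gradient f y) (z - y) ≤ f z := by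
  have hline : HasDerivAt (AffineMap.lineMap y z : ℝ → E d) (z - y) 0 := by
    simpa using (AffineMap.lineMap y z : ℝ →ᵃ[ℝ] E d).hasDerivAt (x := 0)
  have hd' : HasFDerivAt f (fderiv ℝ f y) (AffineMap.lineMap y z (0 : ℝ)) := by
    simpa using hd.hasFDerivAt
  have h := (hf.comp_affineMap (AffineMap.lineMap y z)).le_slope_of_hasDerivAt
    (mem_univ (0 : ℝ)) (mem_univ (1 : ℝ)) zero_lt_one (hd'.comp_hasDerivAt 0 hline)
  rw [inner_gradient]
  simp only [slope_def_field, Function.comp_apply, AffineMap.lineMap_apply_one,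
    AffineMap.lineMap_apply_zero, sub_zero, div_one] at h
  linarith

theorem inner_clarke_le_of_convexOn (hf : ConvexOn ℝ univ f) (hc : Continuous f) {v : E d}
    (hv : v ∈ clarke f y) (z : E d) : f y + inner ℝ v (z - y) ≤ f z := by
  have hconv : Convex ℝ {v : E d | inner ℝ (z - y) v ≤ f z - f y} :=
    convex_halfSpace_le ((innerₗ (E d) (z - y)).isLinear) _
  have hsub : clarke f y ⊆ {v : E d | inner ℝ (z - y) v ≤ f z - f y} := by
    refine convexHull_min ?_ hconv
    rintro w ⟨s, hs, hsy, hw⟩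
    have h1 : Tendsto (fun n => f (s n) + inner ℝ (gradient f (s n)) (z - s n)) atTop
        (𝓝 (f y + inner ℝ w (z - y))) :=
      ((hc.tendsto y).comp hsy).add (hw.inner (hsy.const_sub z))
    have h2 := le_of_tendsto' h1 fun n => inner_gradient_le_of_convexOn hf (hs n) z
    rw [mem_ofPred_eq, real_inner_comm]
    linarith
  have := hsub hv
  rw [mem_ofPred_eq, real_inner_comm] at this
  linarith

/-- For a Clarke subgradient at `y` near `x`, moving the base point from `y` to `x` costs `L σ` in
the value of `f` and `L σ` in the inner product. The resulting inequality defines a half-space in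
`v`, so it passes to the convex hull. -/
theorem sub_le_of_mem_goldstein (hconv : ConvexOn ℝ univ f) (hc : Continuous f)
    (hf : LipschitzOnWith L f (Metric.ball x 1)) (hσ : σ < 1) {v : E d}
    (hv : v ∈ goldstein f σ x) (z : E d) : f x - f z ≤ ‖v‖ * ‖x - z‖ + L * (2 * σ) := by
  have hhalf : Convex ℝ {v : E d | inner ℝ (z - x) v ≤ f z - f x + L * (2 * σ)} :=
    convex_halfSpace_le ((innerₗ (E d) (z - x)).isLinear) _
  have hsub : goldstein f σ x ⊆ {v : E d | inner ℝ (z - x) v ≤ f z - f x + L * (2 * σ)} := by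
    refine convexHull_min (iUnion₂_subset fun y hy w hw => ?_) hhalf
    have hyb := Metric.closedBall_subset_ball hσ hy
    rw [mem_closedBall_iff_norm] at hy
    have h1 := inner_clarke_le_of_convexOn hconv hc hw z
    have h2 : f x - f y ≤ L * σ := by
      refine (le_abs_self _).trans
        ((abs_sub_le_of_mem_ball hf (Metric.mem_ball_self one_pos) hyb).trans ?_)
      rw [norm_sub_rev]
      gcongr
    have h3 : inner ℝ w (y - x) ≤ L * σ := by
      refine (real_inner_le_norm _ _).trans ?_
      gcongr
      exact norm_le_of_mem_clarke hf hyb hw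
    have h4 : inner ℝ w (z - x) = inner ℝ w (z - y) + inner ℝ w (y - x) := by
      rw [← inner_add_right, sub_add_sub_cancel]
    rw [mem_ofPred_eq, real_inner_comm]
    linarith
  have h1 := hsub hv
  rw [mem_ofPred_eq] at h1
  have h2 : -inner ℝ (z - x) v ≤ ‖v‖ * ‖x - z‖ := by
    rw [norm_sub_rev x z, mul_comm]
    exact (neg_le_abs _).trans (abs_real_inner_le_norm _ _)
  linarith

/-! ### The rate -/

/-- The maximum of the two terms of the rate that do not involve the function gap. -/
noncomputable def threshold (L : NNReal) (σ : ℝ) (K G T : ℕ) (p : ℝ) : ℝ :=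
  max (L * (16 * √(2 * Real.log (K * G / p)) / √(T : ℝ))) (L * (√128 * σ))

theorem rate_coe (Δ : ℝ) (L : NNReal) (σ : ℝ) (K G T : ℕ) (p : ℝ) :
    rate (Δ : EReal) L σ K G T p
      = ((max (8 * Δ / (σ * K)) (threshold L σ K G T p) : ℝ) : EReal) := by
  rw [rate, threshold, EReal.coe_nnreal_eq_coe_real, EReal.coe_strictMono.monotone.map_max,
    EReal.coe_strictMono.monotone.map_max]
  norm_cast

theorem rate_top_gap {σ : ℝ} {K : ℕ} (hσ : 0 < σ) (hK : 0 < K) (L : ENNReal) (G T : ℕ) (p : ℝ) :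
    rate ⊤ L σ K G T p = ⊤ := by
  have h : (0 : ℝ) < σ * K := by positivity
  rw [rate, EReal.mul_top_of_pos (by norm_num),
    EReal.top_div_of_pos_ne_top (EReal.coe_pos.2 h) (EReal.coe_ne_top _), max_eq_left le_top]

theorem rate_top_lipschitz (hσ : 0 < σ) (Δ : EReal) (K G T : ℕ) (p : ℝ) :
    rate Δ ⊤ σ K G T p = ⊤ := by
  rw [rate, EReal.coe_ennreal_top, EReal.top_mul_coe_of_pos (x := √128 * σ) (by positivity),
    max_eq_right le_top, max_eq_right le_top]

theorem threshold_pos (hL : 0 < L) (hσ : 0 < σ) (K G T : ℕ) (p : ℝ) :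
    0 < threshold L σ K G T p :=
  lt_max_of_lt_right (by positivity)

theorem lipschitz_mul_le_threshold (L : NNReal) (σ : ℝ) (K G T : ℕ) (p : ℝ) :
    √128 * L * σ ≤ threshold L σ K G T p := by
  refine le_trans (le_of_eq ?_) (le_max_right _ _)
  ring

theorem one_le_sqrt_mul (hσ : 1 / 8 ≤ σ) : 1 ≤ √128 * σ := by
  have h : (8 : ℝ) ≤ √128 := Real.le_sqrt_of_sq_le (by norm_num)
  nlinarith

/-- For the coarse radii `σ ≥ 1 / 8` the asserted bound exceeds `L`, so the outer subgradient
already satisfies it. Only indices with `i + 4 ≤ G` need the probabilistic argument. -/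
theorem lipschitz_le_threshold (hσ : 1 / 8 ≤ σ) (L : NNReal) (K G T : ℕ) (p : ℝ) :
    (L : ℝ) ≤ threshold L σ K G T p :=
  le_trans (le_mul_of_one_le_right L.2 (one_le_sqrt_mul hσ)) (le_max_right _ _)

/-- The function gap is infinite, or it is the difference to a finite greatest lower bound. -/
theorem gap_eq_top_or (f : E d → ℝ) :
    (∀ x, gap f x = ⊤) ∨ ∃ m : ℝ, IsGLB (range f) m ∧ ∀ x, gap f x = ((f x - m : ℝ) : EReal) := by
  by_cases hb : BddBelow (range f)
  · right
    have hg := isGLB_ciInf hb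
    refine ⟨⨅ y, f y, hg, fun x => ?_⟩
    have h : ⨅ y, (f y : EReal) = ((⨅ y, f y : ℝ) : EReal) := by
      refine le_antisymm ?_ (le_iInf fun y => EReal.coe_le_coe_iff.2 (ciInf_le hb y))
      refine EReal.le_of_forall_lt_iff_le.1 fun c hc => ?_
      obtain ⟨_, ⟨y, rfl⟩, hy⟩ := exists_lt_of_csInf_lt (range_nonempty f) (EReal.coe_lt_coe_iff.1 hc)
      exact (iInf_le _ y).trans (EReal.coe_le_coe_iff.2 hy.le)
    rw [gap, h, EReal.coe_sub]
  · left
    intro x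
    have h : ⨅ y, (f y : EReal) = ⊥ := by
      refine EReal.eq_bot_iff_forall_lt _ |>.2 fun c => ?_
      rw [not_bddBelow_iff] at hb
      obtain ⟨_, ⟨y, rfl⟩, hy⟩ := hb c
      exact (iInf_le _ y).trans_lt (EReal.coe_lt_coe_iff.2 hy)
    rw [gap, h, EReal.coe_sub_bot]

/-! ### The final argument -/

namespace Run

variable {Ω : Type*} [mΩ : MeasurableSpace Ω] {μ : Measure Ω} {g₀ : E d} {c₀ : ℝ} {Gs Ts : ℕ → ℕ}
  (R : Run μ f x₀ g₀ c₀ Gs Ts)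

/-- Outcomes for which none of the relevant calls of normal descent ends in a critical state. -/
def Successful (L : NNReal) (K G T : ℕ) (p : ℝ) (ω : Ω) : Prop :=
  R.DrawsMem ω ∧ ∀ k ∈ Finset.Icc K (2 * K - 1), ∀ i ∈ (Finset.range G).filter (· + 4 ≤ G),
    ¬ Critical f x₀ L (gridRadius (Gs k) (i + (Gs k - G)))
      (threshold L (gridRadius G i) K G T p) (R.x k ω) (R.b k (i + (Gs k - G)) (Ts k) ω)

theorem norm_g_le (hf : ∀ x, f x ≤ f x₀ → LipschitzOnWith L f (Metric.ball x 1)) (k : ℕ) (ω : Ω) :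
    ‖R.g k ω‖ ≤ L :=
  norm_le_of_mem_clarke (hf _ (R.f_x_le k ω)) (Metric.mem_ball_self one_pos) (R.g_mem k ω)

theorem g_mem_goldstein (hσ : 0 ≤ σ) (k : ℕ) (ω : Ω) : R.g k ω ∈ goldstein f σ (R.x k ω) :=
  clarke_subset_goldstein (by simpa using hσ) (R.g_mem k ω)

theorem descent {K G T : ℕ} {p : ℝ} {ω : Ω} (hω : R.Successful L K G T p ω)
    (hf : ∀ x, f x ≤ f x₀ → LipschitzOnWith L f (Metric.ball x 1))
    (hg₀ : g₀ ≠ 0) (hg₀L : ‖g₀‖ ≤ L) (hc₀ : c₀ ∈ Ioc (0 : ℝ) 1) {i : ℕ} (hi : i + 4 ≤ G)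
    {k : ℕ} (hk : k ∈ Finset.Icc K (2 * K - 1)) (hG : G ≤ Gs k) {B : ℝ}
    (hB : threshold L (gridRadius G i) K G T p ≤ B)
    (hdist : B < Metric.infDist 0 (goldstein f (gridRadius G i) (R.x k ω))) :
    f (R.x (k + 1) ω) < f (R.x k ω) - gridRadius G i / 8 * B := by
  -- Grids of different sizes agree at their coarse end: index `i + (Gs k - G)` of iteration `k` has
  -- the radius of index `i` on the grid of size `G`.
  have hrad := gridRadius_add_sub hG i
  have hi' : i + (Gs k - G) < Gs k := by omega
  have hσ0 := gridRadius_pos G i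
  have hσ1 : gridRadius G i < 1 := gridRadius_lt_one (by omega)
  have hL0 : (0 : ℝ) < L := (norm_pos_iff.2 hg₀).trans_le hg₀L
  have hM0 : 0 < threshold L (gridRadius G i) K G T p :=
    threshold_pos (by exact_mod_cast hL0) hσ0 _ _ _ _
  set v := R.b k (i + (Gs k - G)) (Ts k) ω with hv
  have hvs : R.v k (i + (Gs k - G) + 1) ω = v := R.v_succ k _ hi' ω
  have hvmem : v ∈ goldstein f (gridRadius G i) (R.x k ω) := by
    rw [← hrad]; exact R.b_mem_goldstein hω.1 hi' le_rfl
  have hvB : B < ‖v‖ := hdist.trans_le (by simpa using Metric.infDist_le_dist_of_mem (x := 0) hvmem)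
  have hvL : ‖v‖ ≤ L := norm_le_of_mem_goldstein (hf _ (R.f_x_le k ω)) hσ1 hvmem
  have hv0 : 0 < ‖v‖ := (hM0.trans_le hB).trans hvB
  have hna : ¬ LoopActive f (R.x k ω) (gridRadius G i) v := by
    intro hact
    refine hω.2 k hk i (by simp; omega) ⟨R.f_x_le k ω, ?_, hB.trans_lt hvB, hvL⟩
    rw [hrad]; exact hact
  have hdesc : gridRadius G i / 8 * ‖v‖
      < f (R.x k ω) - f (normStep (R.x k ω) (gridRadius G i) v) := by
    by_contra hcon
    exact hna ⟨hv0, not_lt.1 hcon⟩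
  have hcand : normStep (R.x k ω) (gridRadius G i) v ∈
      candidates (R.x k ω) (max ‖R.g k ω‖ (c₀ * ‖g₀‖)) (Gs k) (fun i => R.v k i ω) := by
    refine Or.inr ⟨i + (Gs k - G), hi', ?_, ?_⟩
    · simp only [hvs, hrad]
      have hs0 : 0 < max ‖R.g k ω‖ (c₀ * ‖g₀‖) :=
        lt_max_of_lt_right (mul_pos hc₀.1 (norm_pos_iff.2 hg₀))
      have hsL : max ‖R.g k ω‖ (c₀ * ‖g₀‖) ≤ L :=
        max_le (R.norm_g_le hf k ω)
          ((mul_le_of_le_one_left (norm_nonneg _) hc₀.2).trans hg₀L)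
      rw [le_div_iff₀ hs0]
      have h1 : (1 : ℝ) ≤ √128 := Real.le_sqrt_of_sq_le (by norm_num)
      have h2 := (lipschitz_mul_le_threshold L (gridRadius G i) K G T p).trans (hB.trans hvB.le)
      calc gridRadius G i * max ‖R.g k ω‖ (c₀ * ‖g₀‖) ≤ gridRadius G i * L := by gcongr
        _ = 1 * L * gridRadius G i := by ring
        _ ≤ √128 * L * gridRadius G i := by gcongr
        _ ≤ ‖v‖ := h2
    · simp only [hvs, hrad]
  have h1 := R.x_succ_le k ω _ hcand
  have h2 : gridRadius G i / 8 * B ≤ gridRadius G i / 8 * ‖v‖ := by gcongr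
  linarith

theorem exists_infDist_le {K G T : ℕ} {p : ℝ} {ω : Ω} (hω : R.Successful L K G T p ω)
    (hf : ∀ x, f x ≤ f x₀ → LipschitzOnWith L f (Metric.ball x 1))
    (hg₀ : g₀ ≠ 0) (hg₀L : ‖g₀‖ ≤ L) (hc₀ : c₀ ∈ Ioc (0 : ℝ) 1) (hK : 0 < K)
    (hG : ∀ k ∈ Finset.Icc K (2 * K - 1), G ≤ Gs k) {m : ℝ} (hm : ∀ y, m ≤ f y) (i : ℕ) :
    ∃ k ∈ Finset.Icc K (2 * K - 1),
      Metric.infDist 0 (goldstein f (gridRadius G i) (R.x k ω))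
        ≤ max (8 * (f (R.x K ω) - m) / (gridRadius G i * K))
            (threshold L (gridRadius G i) K G T p) := by
  have hσ0 := gridRadius_pos G i
  by_cases hi : i + 4 ≤ G
  swap
  · refine ⟨K, by simp; omega, ?_⟩
    have h1 := Metric.infDist_le_dist_of_mem (x := 0) (R.g_mem_goldstein hσ0.le K ω)
    rw [dist_zero_left] at h1
    exact h1.trans ((R.norm_g_le hf K ω).trans
      ((lipschitz_le_threshold (one_eighth_le_gridRadius (by omega)) L K G T p).trans
        (le_max_right _ _)))
  by_contra! hcon
  set B := max (8 * (f (R.x K ω) - m) / (gridRadius G i * K))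
    (threshold L (gridRadius G i) K G T p) with hB
  have hstep : ∀ k ∈ Finset.Icc K (2 * K - 1),
      f (R.x (k + 1) ω) < f (R.x k ω) - gridRadius G i / 8 * B := fun k hk =>
    R.descent hω hf hg₀ hg₀L hc₀ hi hk (hG k hk) (le_max_right _ _) (hcon k hk)
  have hsum : ∀ n < K, f (R.x (K + n + 1) ω) < f (R.x K ω) - (n + 1) * (gridRadius G i / 8 * B) := by
    intro n
    induction n with
    | zero =>
      intro _
      simpa using hstep K (by simp; omega)
    | succ n ih =>
      intro hn
      have h1 := ih (by omega)
      have h2 := hstep (K + n + 1) (by simp; omega)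
      rw [← add_assoc]
      push_cast
      linarith
  -- The window yields `K` decreases, the last one leading to the iterate `2 K`, just outside the
  -- window.
  have h1 := hsum (K - 1) (by omega)
  have h2 : (((K - 1 : ℕ) : ℝ) + 1) = K := by
    exact_mod_cast Nat.sub_add_cancel hK
  rw [h2] at h1
  have hK' : (0 : ℝ) < K := by exact_mod_cast hK
  have h3 : 8 * (f (R.x K ω) - m) / (gridRadius G i * K) ≤ B := le_max_left _ _
  rw [div_le_iff₀ (by positivity)] at h3
  have h4 := hm (R.x (K + (K - 1) + 1) ω)
  linarith

theorem sub_le_of_convexOn {K G T : ℕ} {p : ℝ} {ω : Ω} (hω : R.Successful L K G T p ω)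
    (hf : ∀ x, f x ≤ f x₀ → LipschitzOnWith L f (Metric.ball x 1)) (hc : Continuous f)
    (hconv : ConvexOn ℝ univ f)
    (hg₀ : g₀ ≠ 0) (hg₀L : ‖g₀‖ ≤ L) (hc₀ : c₀ ∈ Ioc (0 : ℝ) 1) (hK : 0 < K)
    (hG : ∀ k ∈ Finset.Icc K (2 * K - 1), G ≤ Gs k) {m : ℝ} (hm : ∀ y, m ≤ f y) {i : ℕ}
    (hi : i ≤ G) {D : ℝ} (hD : ∀ y ∈ sublevel f x₀, ∀ z ∈ sublevel f x₀, ‖y - z‖ ≤ D) (z : E d) :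
    f (R.x (2 * K - 1) ω) - f z ≤ D * max (8 * (f (R.x K ω) - m) / (gridRadius G i * K))
      (threshold L (gridRadius G i) K G T p) + L * (2 * gridRadius G i) := by
  have hσ0 := gridRadius_pos G i
  set B := max (8 * (f (R.x K ω) - m) / (gridRadius G i * K))
    (threshold L (gridRadius G i) K G T p) with hB
  have hD0 : 0 ≤ D := (norm_nonneg _).trans (hD x₀ (le_refl (f x₀)) x₀ (le_refl (f x₀)))
  have hB0 : 0 ≤ B := by
    refine le_trans ?_ (le_max_right _ _)
    exact le_trans (by positivity) (lipschitz_mul_le_threshold L (gridRadius G i) K G T p)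
  have hbound : 0 ≤ D * B + L * (2 * gridRadius G i) := by positivity
  -- Outside the sublevel set `D` says nothing about `z`, but there the left side is negative.
  obtain hz | hz := le_or_gt (f z) (f x₀)
  swap
  · have := R.f_x_le (2 * K - 1) ω
    linarith
  obtain ⟨k, hk, hdist⟩ := R.exists_infDist_le hω hf hg₀ hg₀L hc₀ hK hG hm i
  have hlast : f (R.x (2 * K - 1) ω) ≤ f (R.x k ω) :=
    R.f_x_antitone ω (Finset.mem_Icc.1 hk).2
  have hxz : ‖R.x k ω - z‖ ≤ D := hD _ (R.f_x_le k ω) _ hz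
  refine le_trans (sub_le_sub_right hlast _) ?_
  rcases hi.lt_or_eq with hi | rfl
  -- The Goldstein subdifferential is not known to be closed, so the distance is only approximated;
  -- dividing by `D + 1` allows `D = 0`.
  · refine le_of_forall_pos_le_add fun ε hε => ?_
    have hlt : Metric.infDist 0 (goldstein f (gridRadius G i) (R.x k ω)) < B + ε / (D + 1) :=
      hdist.trans_lt (lt_add_of_pos_right _ (by positivity))
    obtain ⟨v, hv, hvB⟩ := (Metric.infDist_lt_iff ⟨_, R.g_mem_goldstein hσ0.le k ω⟩).1 hlt
    rw [dist_zero_left] at hvB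
    have h1 := sub_le_of_mem_goldstein hconv hc (hf _ (R.f_x_le k ω))
      (gridRadius_lt_one hi) hv z
    have h2 : ‖v‖ * ‖R.x k ω - z‖ ≤ (B + ε / (D + 1)) * D := by gcongr
    have h3 : ε / (D + 1) * D ≤ ε := by
      rw [div_mul_eq_mul_div, div_le_iff₀ (by positivity)]
      nlinarith
    linarith
  -- For `i = G` the radius is `1`, beyond the reach of the Lipschitz bound. The outer subgradient,
  -- which lies in the Goldstein subdifferential of radius `0`, is used instead.
  · have h1 := sub_le_of_mem_goldstein hconv hc (hf _ (R.f_x_le k ω)) one_pos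
      (R.g_mem_goldstein le_rfl k ω) z
    have hgB : ‖R.g k ω‖ ≤ B := (R.norm_g_le hf k ω).trans
      ((lipschitz_le_threshold (one_eighth_le_gridRadius (by omega)) L K i T p).trans
        (le_max_right _ _))
    have h2 : ‖R.g k ω‖ * ‖R.x k ω - z‖ ≤ B * D := by gcongr
    have h3 : 0 ≤ L * (2 * gridRadius i i) := by positivity
    linarith

/-! ### The probability of success -/

/-- The second term of the rate squares to `512 L² l / T` with `l = log (K G / p)`, so the exponent
is at most `1 - 16 l`. Since `G ≥ 4`, `K G / p ≥ 4 > e` and `l ≥ 1`, which absorbs the summand `1`.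
-/
theorem exp_le_of_threshold (hL : 0 < L) {K G T T' : ℕ} {p : ℝ} (hp : p ∈ Ioo (0 : ℝ) 1)
    (hK : 0 < K) (hG : 4 ≤ G) (hT : 0 < T) (hTT' : T ≤ T') :
    Real.exp (1 - T' * (threshold L σ K G T p ^ 2 / (32 * L ^ 2))) ≤ p / (K * G) := by
  have hp0 := hp.1
  have hK' : (1 : ℝ) ≤ K := by exact_mod_cast hK
  have hG' : (4 : ℝ) ≤ G := by exact_mod_cast hG
  have hT' : (0 : ℝ) < T := by exact_mod_cast hT
  have hL' : (0 : ℝ) < L := by exact_mod_cast hL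
  have hTT : (T : ℝ) ≤ T' := by exact_mod_cast hTT'
  set l := Real.log (K * G / p) with hl
  have h4 : (4 : ℝ) ≤ K * G / p := by
    rw [le_div_iff₀ hp0]
    nlinarith [hp.2]
  have hl1 : 1 ≤ l := by
    rw [hl, Real.le_log_iff_exp_le (by linarith)]
    linarith [Real.exp_one_lt_d9]
  set M := threshold L σ K G T p with hM
  have hM1 : 512 * L ^ 2 * l / T ≤ M ^ 2 := by
    have h1 : L * (16 * √(2 * l) / √(T : ℝ)) ≤ M := le_max_left _ _
    have h2 : (L * (16 * √(2 * l) / √(T : ℝ))) ^ 2 = 512 * L ^ 2 * l / T := by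
      rw [mul_pow, div_pow, mul_pow, Real.sq_sqrt (by positivity), Real.sq_sqrt hT'.le]
      ring
    rw [← h2]
    gcongr
  have h5 : 16 * l ≤ T' * (M ^ 2 / (32 * L ^ 2)) := by
    calc 16 * l = T * (512 * L ^ 2 * l / T / (32 * L ^ 2)) := by field_simp; norm_num
      _ ≤ T' * (M ^ 2 / (32 * L ^ 2)) := by gcongr
  calc Real.exp (1 - T' * (M ^ 2 / (32 * L ^ 2))) ≤ Real.exp (-l) := by
        apply Real.exp_le_exp.2; linarith
    _ = p / (K * G) := by
        rw [Real.exp_neg, hl, Real.exp_log (by linarith), inv_div]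

variable [IsProbabilityMeasure μ]

theorem measure_not_successful_le (hfc : Continuous f)
    (hf : ∀ x, f x ≤ f x₀ → LipschitzOnWith L f (Metric.ball x 1)) (hL : 0 < L) {K G T : ℕ}
    {p : ℝ} (hp : p ∈ Ioo (0 : ℝ) 1) (hK : 0 < K) (hT : 0 < T)
    (hG : ∀ k ∈ Finset.Icc K (2 * K - 1), G ≤ Gs k)
    (hTs : ∀ k ∈ Finset.Icc K (2 * K - 1), T ≤ Ts k) :
    μ {ω | ¬ R.Successful L K G T p ω} ≤ ENNReal.ofReal p := by
  set c : ℕ → ℕ → Set Ω := fun k i => {ω |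
    Critical f x₀ L (gridRadius (Gs k) (i + (Gs k - G)))
      (threshold L (gridRadius G i) K G T p) (R.x k ω) (R.b k (i + (Gs k - G)) (Ts k) ω)} with hc
  have hsub : {ω | ¬ R.Successful L K G T p ω} ⊆ {ω | ¬ R.DrawsMem ω} ∪
      ⋃ k ∈ Finset.Icc K (2 * K - 1), ⋃ i ∈ (Finset.range G).filter (· + 4 ≤ G), c k i := by
    intro ω hω
    by_cases hd : R.DrawsMem ω
    · right
      simp only [mem_ofPred_eq, Successful, hd, true_and, not_forall, not_not] at hω
      obtain ⟨k, hk, i, hi, hcrit⟩ := hω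
      exact mem_biUnion hk (mem_biUnion hi hcrit)
    · exact Or.inl hd
  have hcall : ∀ k ∈ Finset.Icc K (2 * K - 1), ∀ i ∈ (Finset.range G).filter (· + 4 ≤ G),
      μ (c k i) ≤ ENNReal.ofReal (p / (K * G)) := by
    intro k hk i hi
    have hi4 : i + 4 ≤ G := (Finset.mem_filter.1 hi).2
    have hGk := hG k hk
    have hrad := gridRadius_add_sub hGk i
    have hσ0 := gridRadius_pos G i
    refine (R.measure_critical_le hfc hf (by omega) ?_ (threshold_pos hL hσ0 _ _ _ _)).trans
      (ENNReal.ofReal_le_ofReal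
        (exp_le_of_threshold hL hp hK (by omega) hT (hTs k hk)))
    rw [hrad]
    exact lipschitz_mul_le_threshold _ _ _ _ _ _
  have hcard : ((Finset.range G).filter (· + 4 ≤ G)).card ≤ G :=
    (Finset.card_filter_le _ _).trans (by simp)
  have hcard' : (Finset.Icc K (2 * K - 1)).card = K := by
    rw [Nat.card_Icc]; omega
  have hp0 := hp.1
  calc μ {ω | ¬ R.Successful L K G T p ω} ≤ μ {ω | ¬ R.DrawsMem ω} +
        μ (⋃ k ∈ Finset.Icc K (2 * K - 1), ⋃ i ∈ (Finset.range G).filter (· + 4 ≤ G), c k i) :=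
        (measure_mono hsub).trans (measure_union_le _ _)
    _ = μ (⋃ k ∈ Finset.Icc K (2 * K - 1), ⋃ i ∈ (Finset.range G).filter (· + 4 ≤ G), c k i) := by
        rw [ae_iff.1 R.ae_drawsMem, zero_add]
    _ ≤ ∑ k ∈ Finset.Icc K (2 * K - 1), ∑ i ∈ (Finset.range G).filter (· + 4 ≤ G), μ (c k i) :=
        (measure_biUnion_finset_le _ _).trans
          (Finset.sum_le_sum fun k _ => measure_biUnion_finset_le _ _)
    _ ≤ ∑ k ∈ Finset.Icc K (2 * K - 1), ∑ i ∈ (Finset.range G).filter (· + 4 ≤ G),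
          ENNReal.ofReal (p / (K * G)) :=
        Finset.sum_le_sum fun k hk => Finset.sum_le_sum fun i hi => hcall k hk i hi
    _ ≤ (K : ENNReal) * (G * ENNReal.ofReal (p / (K * G))) := by
        rw [Finset.sum_const, Finset.sum_const, hcard', nsmul_eq_mul, nsmul_eq_mul]
        gcongr
    _ = ENNReal.ofReal (K * (G * (p / (K * G)))) := by
        rw [ENNReal.ofReal_mul (by positivity), ENNReal.ofReal_mul (by positivity),
          ENNReal.ofReal_natCast, ENNReal.ofReal_natCast]
    _ ≤ ENNReal.ofReal p := by
        refine ENNReal.ofReal_le_ofReal ?_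
        have hK' : (0 : ℝ) < K := by exact_mod_cast hK
        rcases Nat.eq_zero_or_pos G with rfl | hG0
        · simpa using hp0.le
        · have hG' : (0 : ℝ) < G := by exact_mod_cast hG0
          exact le_of_eq (by field_simp)

end Run

end NTDescent

/-! ### Assembly in the extended reals -/

theorem mainTheorem7 {d : ℕ} (f : NTDescent.E d → ℝ) (hf : LocallyLipschitz f)
    (x₀ g₀ : NTDescent.E d) (hg₀ : g₀ ∈ NTDescent.clarke f x₀) (hg₀_ne : g₀ ≠ 0)
    (L : ENNReal)
    (hL : ∀ x ∈ NTDescent.widenedSublevel f x₀, ∀ y ∈ NTDescent.widenedSublevel f x₀,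
      edist (f x) (f y) ≤ L * edist x y)
    (c₀ : ℝ) (hc₀ : c₀ ∈ Set.Ioc (0 : ℝ) 1)
    (Gs Ts : ℕ → ℕ) (hGs : ∀ k, 0 < Gs k) (hTs : ∀ k, 0 < Ts k)
    (p : ℝ) (hp : p ∈ Set.Ioo (0 : ℝ) 1)
    {Ω : Type*} [MeasurableSpace Ω] (μ : MeasureTheory.Measure Ω)
    [MeasureTheory.IsProbabilityMeasure μ]
    (R : NTDescent.Run μ f x₀ g₀ c₀ Gs Ts)
    (K : ℕ) (hK : 0 < K) (G T : ℕ)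
    (hG : IsLeast (Gs '' Set.Icc K (2 * K - 1)) G)
    (hT : IsLeast (Ts '' Set.Icc K (2 * K - 1)) T) :
    ∃ A : Set Ω, MeasurableSet A ∧ ENNReal.ofReal (1 - p) ≤ μ A ∧ ∀ ω ∈ A,
      (∀ i ≤ G,
        ⨅ k ∈ Set.Icc K (2 * K - 1),
            ((Metric.infDist 0
              (NTDescent.goldstein f (NTDescent.gridRadius G i) (R.x k ω)) : ℝ) : EReal)
          ≤ NTDescent.rate (NTDescent.gap f (R.x K ω)) L (NTDescent.gridRadius G i) K G T p) ∧
      (ConvexOn ℝ Set.univ f →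
        NTDescent.gap f (R.x (2 * K - 1) ω) ≤
          ⨅ i ∈ Set.Iic G,
            ((Metric.ediam (NTDescent.sublevel f x₀) : ENNReal) : EReal) *
                NTDescent.rate (NTDescent.gap f (R.x K ω)) L (NTDescent.gridRadius G i) K G T p
              + (L : EReal) * ((2 * NTDescent.gridRadius G i : ℝ) : EReal)) := by
  have hfc : Continuous f := hf.continuous
  have hKmem : K ∈ Set.Icc K (2 * K - 1) := ⟨le_rfl, by omega⟩
  induction L with
  | top =>
    refine ⟨Set.univ, MeasurableSet.univ, ?_, fun ω _ => ⟨fun i _ => ?_, fun _ => ?_⟩⟩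
    · rw [measure_univ, ENNReal.ofReal_le_one]
      linarith [hp.1]
    · rw [NTDescent.rate_top_lipschitz (NTDescent.gridRadius_pos G i)]
      exact le_top
    · refine le_iInf₂ fun i _ => ?_
      have hσ0 := NTDescent.gridRadius_pos G i
      -- The product `D * ⊤` is `0` when `D = 0`, but the summand `2 L σ` is infinite anyway.
      rw [NTDescent.rate_top_lipschitz hσ0, EReal.coe_ennreal_top,
        EReal.top_mul_coe_of_pos (x := 2 * NTDescent.gridRadius G i) (by positivity),
        EReal.add_top_of_ne_bot]
      · exact le_top
      · exact ne_bot_of_le_ne_bot EReal.zero_ne_bot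
          (mul_nonneg (EReal.coe_ennreal_nonneg _) le_top)
  | coe L =>
    have hlip : ∀ x, f x ≤ f x₀ → LipschitzOnWith L f (Metric.ball x 1) :=
      fun x hx => NTDescent.lipschitzOnWith_ball hL hx
    have hg₀L : ‖g₀‖ ≤ L :=
      NTDescent.norm_le_of_mem_clarke (hlip x₀ le_rfl) (Metric.mem_ball_self one_pos) hg₀
    have hL0 : 0 < L := by exact_mod_cast (norm_pos_iff.2 hg₀_ne).trans_le hg₀L
    have hGle : ∀ k ∈ Finset.Icc K (2 * K - 1), G ≤ Gs k := fun k hk =>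
      hG.2 ⟨k, Finset.mem_Icc.1 hk, rfl⟩
    have hTle : ∀ k ∈ Finset.Icc K (2 * K - 1), T ≤ Ts k := fun k hk =>
      hT.2 ⟨k, Finset.mem_Icc.1 hk, rfl⟩
    have hT0 : 0 < T := by
      obtain ⟨k, -, rfl⟩ := hT.1
      exact hTs k
    have hbad := R.measure_not_successful_le hfc hlip hL0 hp hK hT0 hGle hTle
    -- Success need not be a measurable event, so its complement is enlarged to a measurable set of
    -- equal measure.
    refine ⟨(toMeasurable μ {ω | ¬ R.Successful L K G T p ω})ᶜ,
      (measurableSet_toMeasurable _ _).compl, ?_, fun ω hω => ?_⟩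
    · rw [prob_compl_eq_one_sub (measurableSet_toMeasurable _ _), measure_toMeasurable,
        ENNReal.ofReal_sub _ hp.1.le, ENNReal.ofReal_one]
      exact tsub_le_tsub_left hbad 1
    have hsucc : R.Successful L K G T p ω := by
      by_contra hcon
      exact hω (subset_toMeasurable _ _ hcon)
    rcases NTDescent.gap_eq_top_or f with hgap | ⟨m, hm, hgap⟩
    · refine ⟨fun i _ => ?_, fun _ => le_iInf₂ fun i _ => ?_⟩
      · rw [hgap, NTDescent.rate_top_gap (NTDescent.gridRadius_pos G i) hK]
        exact le_top
      · have hσ0 := NTDescent.gridRadius_pos G i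
        -- Excludes `0 * ⊤ = 0`: a sublevel set of diameter `0` would make `x₀` a minimizer,
        -- contradicting the infinite gap.
        have hD : Metric.ediam (NTDescent.sublevel f x₀) ≠ 0 := by
          intro h0
          have hss := Metric.ediam_eq_zero_iff.1 h0
          have hx₀ : ∀ y, f x₀ ≤ f y := by
            intro y
            by_contra! hy
            have : y = x₀ := hss hy.le (le_refl (f x₀))
            exact hy.ne (by rw [this])
          have h1 : NTDescent.gap f x₀ ≤ 0 := by
            rw [NTDescent.gap, EReal.sub_nonpos]
            exact le_iInf fun y => EReal.coe_le_coe_iff.2 (hx₀ y)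
          rw [hgap] at h1
          exact absurd h1 (by simp)
        rw [hgap (R.x K ω), NTDescent.rate_top_gap hσ0 hK, EReal.mul_top_of_pos
          (by simpa [pos_iff_ne_zero] using hD), EReal.top_add_of_ne_bot]
        · exact le_top
        · rw [EReal.coe_nnreal_eq_coe_real, ← EReal.coe_mul]
          exact EReal.coe_ne_bot _
    · have hm' : ∀ y, m ≤ f y := fun y => hm.1 ⟨y, rfl⟩
      refine ⟨fun i _ => ?_, fun hconv => le_iInf₂ fun i hi => ?_⟩
      · obtain ⟨k, hk, hdist⟩ :=
          R.exists_infDist_le hsucc hlip hg₀_ne hg₀L hc₀ hK hGle hm' i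
        refine (iInf₂_le k (Finset.mem_Icc.1 hk)).trans ?_
        rw [hgap, NTDescent.rate_coe]
        exact EReal.coe_le_coe_iff.2 hdist
      · have hσ0 := NTDescent.gridRadius_pos G i
        rw [hgap, hgap, NTDescent.rate_coe, EReal.coe_nnreal_eq_coe_real, ← EReal.coe_mul]
        by_cases hD : Metric.ediam (NTDescent.sublevel f x₀) = ⊤
        · rw [hD, EReal.coe_ennreal_top, EReal.top_mul_coe_of_pos
            (lt_max_of_lt_right (NTDescent.threshold_pos hL0 hσ0 _ _ _ _)),
            EReal.top_add_of_ne_bot (EReal.coe_ne_bot _)]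
          exact le_top
        · have hDb : ∀ y ∈ NTDescent.sublevel f x₀, ∀ z ∈ NTDescent.sublevel f x₀,
              ‖y - z‖ ≤ (Metric.ediam (NTDescent.sublevel f x₀)).toReal := by
            intro y hy z hz
            rw [← dist_eq_norm, dist_edist]
            exact ENNReal.toReal_mono hD (Metric.edist_le_ediam_of_mem hy hz)
          rw [← EReal.coe_ennreal_toReal hD, ← EReal.coe_mul, ← EReal.coe_add,
            EReal.coe_le_coe_iff, sub_le_comm]
          -- The infimum may not be attained, so the bound is proved against every `z` and passed to
          -- the greatest lower bound.
          refine hm.2 ?_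
          rintro _ ⟨z, rfl⟩
          rw [sub_le_comm]
          exact R.sub_le_of_convexOn hsucc hlip hfc hconv hg₀_ne hg₀L hc₀ hK hGle hm' hi hDb z
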